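/- **Setting.** Let $n\ge 1$ be a natural number, $K,M>0$ and $a>0$ rational numbers, and $M_1\ge 0$ a real number with $$0<a\le \frac{K}{M(1+nM_1)} .$$ For $R\ge 0$ let $\mathbf I[-R,R]^m$ be the set of hyper-rectangles $\prod_i[\alpha_i,\beta_i]\subseteq[-R,R]^m$, ordered by reverse inclusion ($\alpha\sqsubseteq\beta$ iff $\beta\subseteq\alpha$); its bottom element is $[-R,R]^m$. Interval sums and products of interval matrices with interval vectors are those of interval arithmetic, integrals of interval functions are taken bound by bound, and $\alpha\oplus r=\prod_i[\alpha_i-r,\beta_i+r]$. Let $T_K$ map a hyper-rectangle of $\mathbb R^n$ to its image under the coordinatewise nearest-point projection onto $[-K,K]^n$; thus $T_K(\alpha)=\alpha\cap[-K,K]^n$ whenever this intersection is non-empty. **Vector field.** Let $f:[-K,K]^n\to[-M,M]^n$ satisfy $|f_i(x)-f_i(y)|\le M_1\sum_j|x_j-y_j|$ for all $i,x,y$ (this holds if $f$ is Lipschitz with constant $M_1$ for one of the $p$-norms). For $h:[-K,K]^n\to\mathbb R$ let $\overline L(h)(x)$ be the intersection of all hyper-rectangles $b$ for which there is a relatively open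 $O\ni x$ in $[-K,K]^n$ with $h(y)-h(z)\in b\cdot(y-z)$ for all $y,z\in O$ (it is $\mathbb R^n$ if there is none); for vector-valued $h$, $\overline L(h)$ is the interval matrix with rows $\overline L(h_i)$. The canonical extension $\mathbf I h$ of a (set-valued) map $h$ sends a hyper-rectangle $\alpha$ to the smallest hyper-rectangle (possibly the whole space) that contains all the values of $h$ on $\alpha$. Let $\mathcal V^1$ be the set of pairs $(u,u')$ of Scott-continuous maps $u:\mathbf I[-K,K]^n\to\mathbf I[-M,M]^n$, $u':\mathbf I[-K,K]^n\to\mathbf I[-M_1,M_1]^{n^2}$ such that $u\sqsubseteq\mathbf I h$ and $u'\sqsubseteq\mathbf I(\overline L(h))$ for some $h:[-K,K]^n\to[-M,M]^n$, and let $\mathcal V^1_f$ be the set of $(u,u')\in\mathcal V^1$ with $u\sqsubseteq\mathbf I f$ and $u'\sqsubseteq\mathbf I(\overline L(f))$. **The domain $\mathcal W_{\mathcal D}$.** Let $\mathcal B_{\mathcal D}$ be the set of step functions $[0,a]\to\mathbf I[-K,K]^n$, i.e. of the existing pointwise suprema of finitely many single-step functions $b\chi_O$ (with value $b$ on $O$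 and $\bot$ elsewhere), where $O=(p,q]\cap[0,a]$ with $p,q\in\mathbb Q$ and $b\in\mathbf I[-K,K]^n$ has rational coordinates. For $\theta=\bigsqcup_i b_i\chi_{O_i}$ and $\theta'$ in $\mathcal B_{\mathcal D}$ write $\theta\prec\theta'$ if $b_i\ll\theta'(t)$ for all $i$ and $t\in O_i$, with $\ll$ the way-below relation of $\mathbf I[-K,K]^n$; for arbitrary $g,g':[0,a]\to\mathbf I[-K,K]^n$ write $g\prec g'$ if $g\sqsubseteq\theta\prec\theta'\sqsubseteq g'$ for some $\theta,\theta'\in\mathcal B_{\mathcal D}$. Let $\mathcal W_{\mathcal D}$ be the set of rounded ideals of $(\mathcal B_{\mathcal D},\prec)$, ordered by inclusion, with bottom element $\bot$. For $g:[0,a]\to\mathbf I[-K,K]^n$ let $g_*=\{b\in\mathcal B_{\mathcal D}: b\prec g\}\in\mathcal W_{\mathcal D}$, and for $\phi\in\mathcal W_{\mathcal D}$ let $\phi^*=\bigsqcup_{b\in\phi}b$ (pointwise). **The operators.** Let $Q=(q_0,\dots,q_k)$, $k\ge1$, be a partition $0=q_0<\dots<q_k=a$ with rational points and $|Q|=\max_j\Delta_j\le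 1$, where $\Delta_j=q_{j+1}-q_j$, and let $(u,u')\in\mathcal V^1_f$. For $\phi:[0,a]\to\mathbf I[-K,K]^n$ define $\Phi_{(u,u')}(Q)(\phi)(0)=\{0\}$ and, for $q_j<x\le q_{j+1}$, $$\Phi_{(u,u')}(Q)(\phi)(x)=T_K\Big[\phi(q_j)+\int_{q_j}^x u(\phi(q_j))+(t-q_j)\,(u'\cdot u)\big(T_K(\phi(q_j)\oplus M\Delta_j)\big)\,dt\Big],$$ and let $F_{(u,u')}(Q):\mathcal W_{\mathcal D}\to\mathcal W_{\mathcal D}$, $F_{(u,u')}(Q)(\phi)=\big(\Phi_{(u,u')}(Q)(\phi^*)\big)_*$. The second-order Euler enclosure $E=E^2_{(u,u')}(Q)$ is defined by recursion: $E(0)=\{0\}$ and, for $q_j<x\le q_{j+1}$, $$E(x)=E(q_j)+\int_{q_j}^x u(E(q_j))+(t-q_j)\,(u'\cdot u)\big(E(q_j)\oplus M\Delta_j\big)\,dt .$$ **Theorem.** The recursion for $E^2_{(u,u')}(Q)$ is well defined, i.e. $E^2_{(u,u')}(Q)(q_j)\oplus M\Delta_j\subseteq[-K,K]^n$ for every $j<k$.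 The operator $F_{(u,u')}(Q)$ is Scott-continuous, and for its least fixpoint $y$, $$y=\bigsqcup_{m\in\mathbb N}\big(F_{(u,u')}(Q)\big)^m(\bot)=\big(F_{(u,u')}(Q)\big)^{k+1}(\bot)\qquad\text{and}\qquad E^2_{(u,u')}(Q)=y^* .$$ -/

import Mathlib

open scoped NNReal

namespace EulerDomain

/-! ### Domain theory: way-below, step functions, separation order, rounded ideals -/

section Generic

/-- The way-below relation `x ≪ y`. -/
def WayBelow {D : Type*} [PartialOrder D] (x y : D) : Prop :=
  ∀ S : Set D, S.Nonempty → DirectedOn (· ≤ ·) S →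
    ∀ s, IsLUB S s → y ≤ s → ∃ d ∈ S, x ≤ d

open Classical in
/-- The single-step function `b χ_O`. -/
noncomputable def singleStep {X D : Type*} [PartialOrder D] [OrderBot D] (O : Set X) (b : D) :
    X → D :=
  fun x => if x ∈ O then b else ⊥

/-- `S` is a finite family of pairs `(O, b)`, with `O` in the base `BX` and `b` in the basis `BD`,
and `θ` is the (pointwise) supremum of the single-step functions `b χ_O`. -/
def Presents {X D : Type*} [PartialOrder D] [OrderBot D] (BX : Set (Set X)) (BD : Set D)
    (S : Set (Set X × D)) (θ : X → D) : Prop :=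
  S.Finite ∧ (∀ s ∈ S, s.1 ∈ BX ∧ s.2 ∈ BD) ∧ IsLUB ((fun s => singleStep s.1 s.2) '' S) θ

/-- The step functions over the base `BX` and the basis `BD`. -/
structure StepFun {X D : Type*} [PartialOrder D] [OrderBot D] (BX : Set (Set X)) (BD : Set D) where
  toFun : X → D
  isStep : ∃ S, Presents BX BD S toFun

/-- The separation order on step functions: for `θ = ⨆ bᵢ χ_{Oᵢ}`, every `Oᵢ` is contained in the
preimage under `θ'` of the set of elements which are way above `bᵢ`.  (The relation does not depend
on the presentation of `θ`.) -/
def StepSep {X D : Type*} [PartialOrder D] [OrderBot D] {BX : Set (Set X)} {BD : Set D}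
    (θ θ' : StepFun BX BD) : Prop :=
  ∃ S, Presents BX BD S θ.1 ∧ ∀ s ∈ S, s.1 ⊆ θ'.1 ⁻¹' {d | WayBelow s.2 d}

/-- The separation order on arbitrary functions. -/
def Sep {X D : Type*} [PartialOrder D] [OrderBot D] (BX : Set (Set X)) (BD : Set D)
    (f g : X → D) : Prop :=
  ∃ θ₁ θ₂ : StepFun BX BD, f ≤ θ₁.1 ∧ StepSep θ₁ θ₂ ∧ θ₂.1 ≤ g

/-- Rounded ideals of a set equipped with a binary relation. -/
structure RoundedIdeal {B : Type*} (r : B → B → Prop) where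
  carrier : Set B
  nonempty : carrier.Nonempty
  lower : ∀ y ∈ carrier, ∀ x, r x y → x ∈ carrier
  directed : ∀ A : Finset B, ↑A ⊆ carrier → ∃ z ∈ carrier, ∀ x ∈ A, r x z

theorem RoundedIdeal.carrier_injective {B : Type*} {r : B → B → Prop} :
    Function.Injective (RoundedIdeal.carrier (r := r)) := by
  rintro ⟨_, _, _, _⟩ ⟨_, _, _, _⟩ h
  cases h
  rfl

/-- Rounded ideals are ordered by inclusion. -/
instance {B : Type*} {r : B → B → Prop} : PartialOrder (RoundedIdeal r) :=
  PartialOrder.lift RoundedIdeal.carrier RoundedIdeal.carrier_injective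

theorem WayBelow.le {D : Type*} [PartialOrder D] {x y : D} (h : WayBelow x y) : x ≤ y := by
  obtain ⟨d, hd, hx⟩ := h {y} ⟨y, rfl⟩ (by simp [DirectedOn]) y (by simp) le_rfl
  exact hx.trans (le_of_eq hd)

theorem WayBelow.mono {D : Type*} [PartialOrder D] {x x' y y' : D} (h : WayBelow x y) (hx : x' ≤ x) (hy : y ≤ y') :
    WayBelow x' y' := by
  intro S hS hd s hs hys
  obtain ⟨d, hdS, h⟩ := h S hS hd s hs (hy.trans hys)
  exact ⟨d, hdS, hx.trans h⟩

theorem WayBelow.of_isLUB {D : Type*} [PartialOrder D] {T : Set D} (hT : T.Finite) {x y : D} (hx : IsLUB T x)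
    (h : ∀ b ∈ T, WayBelow b y) : WayBelow x y := by
  intro S hS hd s hs hys
  have key : ∃ d ∈ S, ∀ b ∈ T, b ≤ d := by
    clear hx
    induction T, hT using Set.Finite.induction_on with
    | empty => obtain ⟨d, hdS⟩ := hS; exact ⟨d, hdS, by simp⟩
    | @insert a T _ _ ih =>
      obtain ⟨d, hdS, h1⟩ := ih (fun b hb => h b (Set.mem_insert_of_mem _ hb))
      obtain ⟨d', hdS', h2⟩ := h a (Set.mem_insert _ _) S hS hd s hs hys
      obtain ⟨e, he, hde, hde'⟩ := hd d hdS d' hdS'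
      refine ⟨e, he, fun b hb => ?_⟩
      rcases hb with rfl | hb
      · exact h2.trans hde'
      · exact (h1 b hb).trans hde
  obtain ⟨d, hdS, h1⟩ := key
  exact ⟨d, hdS, hx.2 h1⟩

variable {X D : Type*} [PartialOrder D] [OrderBot D] {BX : Set (Set X)} {BD : Set D}

theorem Presents.le {S : Set (Set X × D)} {θ : X → D} (h : Presents BX BD S θ)
    {s : Set X × D} (hs : s ∈ S) {t : X} (ht : t ∈ s.1) : s.2 ≤ θ t := by
  have := h.2.2.1 (Set.mem_image_of_mem _ hs) t
  simpa [singleStep, ht] using this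

theorem Presents.isLUB {S : Set (Set X × D)} {θ : X → D} (h : Presents BX BD S θ) (t : X) :
    IsLUB (Prod.snd '' {s ∈ S | t ∈ s.1}) (θ t) := by
  have := (isLUB_pi.1 h.2.2) t
  constructor
  · rintro _ ⟨s, ⟨hs, ht⟩, rfl⟩
    exact h.le hs ht
  · intro y hy
    refine this.2 ?_
    rintro _ ⟨_, ⟨s, hs, rfl⟩, rfl⟩
    by_cases ht : t ∈ s.1
    · simpa [singleStep, ht] using hy ⟨s, ⟨hs, ht⟩, rfl⟩
    · simp [singleStep, ht]

theorem stepSep_iff (θ θ' : StepFun BX BD) :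
    StepSep θ θ' ↔ ∀ t, WayBelow (θ.1 t) (θ'.1 t) := by
  constructor
  · rintro ⟨S, hS, h⟩ t
    refine WayBelow.of_isLUB ((hS.1.subset (Set.sep_subset _ _)).image _) (hS.isLUB t) ?_
    rintro _ ⟨s, ⟨hs, ht⟩, rfl⟩
    exact h s hs ht
  · intro h
    obtain ⟨S, hS⟩ := θ.2
    exact ⟨S, hS, fun s hs t ht => (h t).mono (hS.le hs ht) le_rfl⟩

theorem StepSep.trans {θ₁ θ₂ θ₃ : StepFun BX BD} (h : StepSep θ₁ θ₂) (h' : StepSep θ₂ θ₃) :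
    StepSep θ₁ θ₃ := by
  rw [stepSep_iff] at *
  exact fun t => (h t).mono le_rfl (h' t).le

theorem exists_stepFun {S : Set (Set X × D)}
    (hlub : ∀ T : Set D, T.Finite → BddAbove T → ∃ x, IsLUB T x)
    (hfin : S.Finite) (hS : ∀ s ∈ S, s.1 ∈ BX ∧ s.2 ∈ BD) (f : X → D)
    (hf : ∀ s ∈ S, ∀ t ∈ s.1, s.2 ≤ f t) :
    ∃ θ : StepFun BX BD, Presents BX BD S θ.1 ∧ θ.1 ≤ f := by
  have hle : ∀ s ∈ S, singleStep s.1 s.2 ≤ f := by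
    intro s hs t
    by_cases ht : t ∈ s.1
    · simpa [singleStep, ht] using hf s hs t ht
    · simp [singleStep, ht]
  have h1 : ∀ t, ∃ x, IsLUB ((fun s : Set X × D => singleStep s.1 s.2 t) '' S) x := by
    intro t
    refine hlub _ (hfin.image _) ⟨f t, ?_⟩
    rintro _ ⟨s, hs, rfl⟩
    exact hle s hs t
  choose θ hθ using h1
  have h2 : IsLUB ((fun s => singleStep s.1 s.2) '' S) θ := by
    rw [isLUB_pi]
    intro t
    rw [← Set.image_comp]
    exact hθ t
  refine ⟨⟨θ, S, hfin, hS, h2⟩, ⟨hfin, hS, h2⟩, h2.2 ?_⟩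
  rintro _ ⟨s, hs, rfl⟩
  exact hle s hs

/-- The conditions on `BX`, `BD` and `D` which make the step functions, with the separation order,
an abstract basis. -/
structure GoodBases (BX : Set (Set X)) (BD : Set D) : Prop where
  univ_mem : Set.univ ∈ BX
  inter_mem : ∀ O ∈ BX, ∀ O' ∈ BX, O ∩ O' ∈ BX
  exists_lub : ∀ T : Set D, T.Finite → BddAbove T → ∃ x, IsLUB T x
  interpolate : ∀ x y z : D, WayBelow x z → WayBelow y z →
    ∃ b ∈ BD, WayBelow x b ∧ WayBelow y b ∧ WayBelow b z

theorem GoodBases.sInter_mem {X D : Type*} [PartialOrder D] {BX : Set (Set X)} {BD : Set D}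
    (hB : GoodBases BX BD) {T : Set (Set X)} (hT : T.Finite)
    (h : ∀ O ∈ T, O ∈ BX) : ⋂₀ T ∈ BX := by
  induction T, hT using Set.Finite.induction_on with
  | empty => simpa using hB.univ_mem
  | @insert a T _ _ ih =>
    rw [Set.sInter_insert]
    exact hB.inter_mem _ (h _ (Set.mem_insert _ _)) _
      (ih fun O hO => h O (Set.mem_insert_of_mem _ hO))

theorem GoodBases.stepSep_interpolate (hB : GoodBases BX BD) {θ₁ θ₂ θ : StepFun BX BD}
    (h₁ : StepSep θ₁ θ) (h₂ : StepSep θ₂ θ) :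
    ∃ η : StepFun BX BD, StepSep θ₁ η ∧ StepSep θ₂ η ∧ StepSep η θ := by
  rw [stepSep_iff] at h₁ h₂
  obtain ⟨S₁, hS₁⟩ := θ₁.2
  obtain ⟨S₂, hS₂⟩ := θ₂.2
  obtain ⟨S, hS⟩ := θ.2
  have hfac : ∀ {S : Set (Set X × D)} {θ : X → D}, Presents BX BD S θ → ∀ t t' : X,
      {s ∈ S | t ∈ s.1} = {s ∈ S | t' ∈ s.1} → θ t = θ t' := by
    intro S θ h t t' e
    have := h.isLUB t
    rw [e] at this
    exact this.unique (h.isLUB t')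
  let κ : X → Set (Set X × D) × Set (Set X × D) × Set (Set X × D) := fun t =>
    ({s ∈ S₁ | t ∈ s.1}, {s ∈ S₂ | t ∈ s.1}, {s ∈ S | t ∈ s.1})
  have hκ : (Set.range κ).Finite := by
    refine ((hS₁.1.finite_subsets).prod ((hS₂.1.finite_subsets).prod hS.1.finite_subsets)).subset ?_
    rintro _ ⟨t, rfl⟩
    exact ⟨Set.sep_subset _ _, Set.sep_subset _ _, Set.sep_subset _ _⟩
  choose! v hv using fun c (hc : c ∈ Set.range κ) =>
    (by
      obtain ⟨t, rfl⟩ := hc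
      obtain ⟨b, hb, h1, h2, h3⟩ := hB.interpolate _ _ _ (h₁ t) (h₂ t)
      refine ⟨b, hb, fun t' ht' => ?_⟩
      have e := Prod.ext_iff.1 ht'
      have e' := Prod.ext_iff.1 e.2
      rw [hfac hS₁ t' t e.1, hfac hS₂ t' t e'.1, hfac hS t' t e'.2]
      exact ⟨h1, h2, h3⟩ :
      ∃ b ∈ BD, ∀ t, κ t = c →
        WayBelow (θ₁.1 t) b ∧ WayBelow (θ₂.1 t) b ∧ WayBelow b (θ.1 t))
  let R : Set (Set X × D) × Set (Set X × D) × Set (Set X × D) → Set X := fun c =>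
    ⋂₀ (Prod.fst '' c.2.2)
  have hRle : ∀ t, ∀ t' ∈ R (κ t), θ.1 t ≤ θ.1 t' := by
    intro t t' ht'
    refine (hS.isLUB t).2 ?_
    rintro _ ⟨s, ⟨hs, ht⟩, rfl⟩
    exact hS.le hs (ht' s.1 ⟨s, ⟨hs, ht⟩, rfl⟩)
  have hway : ∀ c ∈ Set.range κ, ∀ t' ∈ R c, WayBelow (v c) (θ.1 t') := by
    rintro _ ⟨t, rfl⟩ t' ht'
    exact ((hv (κ t) ⟨t, rfl⟩).2 t rfl).2.2.mono le_rfl (hRle t t' ht')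
  obtain ⟨η, hη, -⟩ := exists_stepFun (BX := BX) (BD := BD)
    (S := (fun c => (R c, v c)) '' Set.range κ) hB.exists_lub (hκ.image _)
    (by
      rintro _ ⟨_, ⟨t, rfl⟩, rfl⟩
      refine ⟨hB.sInter_mem ((hS.1.subset (Set.sep_subset _ _)).image _) ?_,
        (hv _ ⟨t, rfl⟩).1⟩
      rintro _ ⟨s, ⟨hs, -⟩, rfl⟩
      exact (hS.2.1 s hs).1) θ.1
    (by
      rintro _ ⟨c, hc, rfl⟩ t' ht'
      exact (hway c hc t' ht').le)
  have hmem : ∀ t, t ∈ R (κ t) := by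
    rintro t _ ⟨s, ⟨-, hs⟩, rfl⟩
    exact hs
  have hvη : ∀ t, v (κ t) ≤ η.1 t := fun t =>
    hη.le (s := (R (κ t), v (κ t))) ⟨κ t, ⟨t, rfl⟩, rfl⟩ (hmem t)
  refine ⟨η, ?_, ?_, ⟨_, hη, ?_⟩⟩
  · rw [stepSep_iff]
    exact fun t => ((hv (κ t) ⟨t, rfl⟩).2 t rfl).1.mono le_rfl (hvη t)
  · rw [stepSep_iff]
    exact fun t => ((hv (κ t) ⟨t, rfl⟩).2 t rfl).2.1.mono le_rfl (hvη t)
  · rintro _ ⟨c, hc, rfl⟩ t' ht'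
    exact hway c hc t' ht'

theorem wayBelow_bot (y : D) : WayBelow ⊥ y := fun _ hS _ _ _ _ =>
  ⟨hS.some, hS.some_mem, bot_le⟩

/-- The constant bottom function as a step function (given by the empty family). -/
def botStep (BX : Set (Set X)) (BD : Set D) : StepFun BX BD :=
  ⟨fun _ => ⊥, ∅, Set.finite_empty, by simp, by
    rw [Set.image_empty, isLUB_empty_iff]
    exact fun _ _ => bot_le⟩

theorem botStep_sep (θ : StepFun BX BD) : StepSep (botStep BX BD) θ := by
  rw [stepSep_iff]
  exact fun t => wayBelow_bot _

/-- `f_* = {b | b ≺ f}`, the set of the step functions which are separated from `f`, is a rounded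
ideal. -/
def lowerStar (hB : GoodBases BX BD) (f : X → D) :
    RoundedIdeal (StepSep (BX := BX) (BD := BD)) where
  carrier := {b | Sep BX BD b.1 f}
  nonempty := ⟨botStep BX BD, botStep BX BD, botStep BX BD, le_rfl, botStep_sep _,
    fun _ => bot_le⟩
  lower := by
    rintro y ⟨θ₁, θ₂, h1, h2, h3⟩ x hxy
    rw [stepSep_iff] at hxy
    exact ⟨θ₁, θ₂, fun t => (hxy t).le.trans (h1 t), h2, h3⟩
  directed := by
    have hbin : ∀ x y : StepFun BX BD, Sep BX BD x.1 f → Sep BX BD y.1 f →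
        ∃ z : StepFun BX BD, Sep BX BD z.1 f ∧ StepSep x z ∧ StepSep y z := by
      rintro x y ⟨θ₁, θ₂, h1, h2, h3⟩ ⟨θ₁', θ₂', h1', h2', h3'⟩
      obtain ⟨S, hS⟩ := θ₂.2
      obtain ⟨S', hS'⟩ := θ₂'.2
      obtain ⟨g, hg, hgf⟩ := exists_stepFun (BX := BX) (BD := BD) (S := S ∪ S') hB.exists_lub
        (hS.1.union hS'.1) (fun s hs => hs.elim (hS.2.1 s) (hS'.2.1 s)) f
        (fun s hs t ht => hs.elim (fun hs => (hS.le hs ht).trans (h3 t))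
          (fun hs => (hS'.le hs ht).trans (h3' t)))
      have e : θ₂.1 ≤ g.1 :=
        hS.2.2.2 (upperBounds_mono_set (Set.image_mono Set.subset_union_left) hg.2.2.1)
      have e' : θ₂'.1 ≤ g.1 :=
        hS'.2.2.2 (upperBounds_mono_set (Set.image_mono Set.subset_union_right) hg.2.2.1)
      rw [stepSep_iff] at h2 h2'
      obtain ⟨z, hz, hz', hzg⟩ := hB.stepSep_interpolate (θ₁ := x) (θ₂ := y) (θ := g)
        ((stepSep_iff _ _).2 fun t => (h2 t).mono (h1 t) (e t))
        ((stepSep_iff _ _).2 fun t => (h2' t).mono (h1' t) (e' t))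
      exact ⟨z, ⟨z, g, le_rfl, hzg, hgf⟩, hz, hz'⟩
    intro A
    classical
    induction A using Finset.induction_on with
    | empty =>
      intro _
      exact ⟨botStep BX BD, ⟨botStep BX BD, botStep BX BD, le_rfl, botStep_sep _,
        fun _ => bot_le⟩, by simp⟩
    | @insert x A _ ih =>
      intro hA
      rw [Finset.coe_insert, Set.insert_subset_iff] at hA
      obtain ⟨z, hz, hAz⟩ := ih hA.2
      obtain ⟨w, hw, hxw, hzw⟩ := hbin x z hA.1 hz
      refine ⟨w, hw, fun y hy => ?_⟩
      rcases Finset.mem_insert.1 hy with rfl | hy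
      · exact hxw
      · exact (hAz y hy).trans hzw

theorem lowerStar_bot_le (hB : GoodBases BX BD) (I : RoundedIdeal (StepSep (BX := BX) (BD := BD))) :
    lowerStar hB (fun _ => ⊥) ≤ I := by
  rintro b ⟨θ₁, θ₂, h1, h2, h3⟩
  obtain ⟨z, hz⟩ := I.nonempty
  refine I.lower z hz b ((stepSep_iff _ _).2 fun t => ?_)
  rw [stepSep_iff] at h2
  exact (wayBelow_bot _).mono ((h1 t).trans ((h2 t).le.trans (h3 t))) le_rfl

end Generic

/-! ### Hyper-rectangles and interval arithmetic -/

/-- Hyper-rectangles `∏ᵢ [αᵢ, βᵢ]` of `ℝ^ι`. -/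
abbrev Box (ι : Type*) := NonemptyInterval (ι → ℝ)

/-- The cube `[-R, R]^ι`. -/
def Cube (ι : Type*) (R : ℝ≥0) : Set (ι → ℝ) := Set.Icc (fun _ => -(R : ℝ)) (fun _ => (R : ℝ))

/-- The carrier of the interval domain of `[-R, R]^ι`: the hyper-rectangles contained in
`[-R, R]^ι`. -/
structure IDom (ι : Type*) (R : ℝ≥0) where
  box : Box ι
  subset : (box : Set (ι → ℝ)) ⊆ Cube ι R

section IDom

variable {ι : Type*} {R : ℝ≥0}

/-- Hyper-rectangles are ordered by reverse inclusion. -/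
instance : PartialOrder (IDom ι R) where
  le α β := β.1 ≤ α.1
  le_refl α := le_refl α.1
  le_trans _ _ _ h h' := le_trans h' h
  le_antisymm := by
    rintro ⟨α, _⟩ ⟨β, _⟩ h h'
    cases (le_antisymm h' h : α = β)
    rfl

theorem box_subset_cube_iff (α : Box ι) :
    (α : Set (ι → ℝ)) ⊆ Cube ι R ↔ ∀ i, -(R : ℝ) ≤ α.fst i ∧ α.snd i ≤ R := by
  rw [NonemptyInterval.coe_def, Cube, Set.Icc_subset_Icc_iff α.fst_le_snd]
  simp only [Pi.le_def]
  exact forall_and.symm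

theorem IDom.le_iff {α β : IDom ι R} :
    α ≤ β ↔ ∀ i, α.1.fst i ≤ β.1.fst i ∧ β.1.snd i ≤ α.1.snd i := by
  change β.1 ≤ α.1 ↔ _
  rw [NonemptyInterval.le_def]
  simp only [Pi.le_def]
  exact forall_and.symm

/-- The bottom element is `[-R, R]^ι`. -/
instance : OrderBot (IDom ι R) where
  bot := ⟨⟨(fun _ => -(R : ℝ), fun _ => (R : ℝ)), fun _ => by simp⟩, subset_rfl⟩
  bot_le α := by
    rw [IDom.le_iff]
    exact (box_subset_cube_iff _).1 α.2

/-- The hyper-rectangles in `[-R, R]^ι` with rational coordinates. -/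
def ratBoxes (ι : Type*) (R : ℝ≥0) : Set (IDom ι R) :=
  {α | ∀ i, ∃ p q : ℚ, α.1.fst i = p ∧ α.1.snd i = q}

theorem IDom.exists_isLUB (S : Set (IDom ι R))
    (h : ∀ α ∈ S, ∀ β ∈ S, ∀ i, α.1.fst i ≤ β.1.snd i) : ∃ γ, IsLUB S γ := by
  let L : ι → Set ℝ := fun i => insert (-(R : ℝ)) ((fun α : IDom ι R => α.1.fst i) '' S)
  let U : ι → Set ℝ := fun i => insert (R : ℝ) ((fun α : IDom ι R => α.1.snd i) '' S)
  have hS : ∀ α : IDom ι R, ∀ i, -(R : ℝ) ≤ α.1.fst i ∧ α.1.snd i ≤ R := fun α =>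
    (box_subset_cube_iff _).1 α.2
  have hfs : ∀ α : IDom ι R, ∀ i, α.1.fst i ≤ α.1.snd i := fun α i => α.1.fst_le_snd i
  have hR : (0 : ℝ) ≤ R := R.2
  have hLU : ∀ i, ∀ x ∈ L i, ∀ y ∈ U i, x ≤ y := by
    rintro i x (rfl | ⟨α, hα, rfl⟩) y (rfl | ⟨β, hβ, rfl⟩)
    · linarith
    · exact (hS β i).1.trans (hfs β i)
    · exact (hfs α i).trans (hS α i).2
    · exact h α hα β hβ i
  have hLb : ∀ i, BddAbove (L i) := fun i => ⟨R, fun x hx => hLU i x hx R (Set.mem_insert _ _)⟩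
  have hUb : ∀ i, BddBelow (U i) := fun i => ⟨-R, fun y hy => hLU i _ (Set.mem_insert _ _) y hy⟩
  have hLn : ∀ i, (L i).Nonempty := fun i => Set.insert_nonempty _ _
  have hUn : ∀ i, (U i).Nonempty := fun i => Set.insert_nonempty _ _
  refine ⟨⟨⟨(fun i => sSup (L i), fun i => sInf (U i)), fun i =>
    csSup_le (hLn i) fun x hx => le_csInf (hUn i) fun y hy => hLU i x hx y hy⟩, ?_⟩, ?_, ?_⟩
  · rw [box_subset_cube_iff]
    exact fun i => ⟨le_csSup (hLb i) (Set.mem_insert _ _), csInf_le (hUb i) (Set.mem_insert _ _)⟩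
  · intro α hα
    rw [IDom.le_iff]
    exact fun i => ⟨le_csSup (hLb i) (Set.mem_insert_of_mem _ ⟨α, hα, rfl⟩),
      csInf_le (hUb i) (Set.mem_insert_of_mem _ ⟨α, hα, rfl⟩)⟩
  · intro β hβ
    rw [IDom.le_iff]
    intro i
    constructor
    · refine csSup_le (hLn i) ?_
      rintro x (rfl | ⟨α, hα, rfl⟩)
      · exact (hS β i).1
      · exact (IDom.le_iff.1 (hβ hα) i).1
    · refine le_csInf (hUn i) ?_
      rintro x (rfl | ⟨α, hα, rfl⟩)
      · exact (hS β i).2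
      · exact (IDom.le_iff.1 (hβ hα) i).2

theorem IDom.exists_isLUB_of_directed (S : Set (IDom ι R)) (h : DirectedOn (· ≤ ·) S) :
    ∃ γ, IsLUB S γ := by
  refine IDom.exists_isLUB S fun α hα β hβ i => ?_
  obtain ⟨γ, -, h1, h2⟩ := h α hα β hβ
  exact (IDom.le_iff.1 h1 i).1.trans ((γ.1.fst_le_snd i).trans (IDom.le_iff.1 h2 i).2)

theorem IDom.exists_isLUB_of_bddAbove (S : Set (IDom ι R)) (h : BddAbove S) :
    ∃ γ, IsLUB S γ := by
  obtain ⟨γ, hγ⟩ := h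
  refine IDom.exists_isLUB S fun α hα β hβ i => ?_
  exact (IDom.le_iff.1 (hγ hα) i).1.trans ((γ.1.fst_le_snd i).trans (IDom.le_iff.1 (hγ hβ) i).2)

end IDom

/-- The symmetric expansion `α ⊕ r`. -/
def expand {ι : Type*} (α : Box ι) (r : ℝ≥0) : Box ι :=
  ⟨(fun i => α.fst i - r, fun i => α.snd i + r), fun i => by
    have h1 : α.fst i ≤ α.snd i := α.fst_le_snd i
    have h2 : (0 : ℝ) ≤ r := r.2
    change α.fst i - r ≤ α.snd i + r
    linarith⟩

/-- The nearest-point projection of `ℝ` onto `[-R, R]`. -/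
def clampReal (R : ℝ≥0) (x : ℝ) : ℝ := max (-(R : ℝ)) (min (R : ℝ) x)

/-- The truncation of a hyper-rectangle to `[-R, R]^ι`: its image under the nearest-point projection
onto the cube.  It equals the intersection of `α` with the cube whenever that is non-empty (see
`coe_trunc`). -/
def trunc {ι : Type*} (R : ℝ≥0) (α : Box ι) : IDom ι R :=
  ⟨⟨(fun i => clampReal R (α.fst i), fun i => clampReal R (α.snd i)), fun i =>
    max_le_max le_rfl (min_le_min le_rfl (α.fst_le_snd i))⟩, by
    rw [box_subset_cube_iff]
    exact fun i => ⟨le_max_left _ _,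
      max_le ((neg_nonpos.2 R.2).trans R.2) (min_le_left _ _)⟩⟩

theorem coe_trunc {ι : Type*} (R : ℝ≥0) (α : Box ι)
    (h : ((α : Set (ι → ℝ)) ∩ Cube ι R).Nonempty) :
    ((trunc R α).1 : Set (ι → ℝ)) = (α : Set (ι → ℝ)) ∩ Cube ι R := by
  obtain ⟨z, ⟨hz1, hz2⟩, hz3, hz4⟩ := h
  rw [NonemptyInterval.coe_def, NonemptyInterval.coe_def, Cube,
    Set.Icc_inter_Icc]
  congr 1
  · funext i
    have h1 : α.fst i ≤ R := (hz1 i).trans (hz4 i)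
    change max _ (min _ _) = max (α.fst i) (-(R : ℝ))
    rw [min_eq_right h1, max_comm]
  · funext i
    have h1 : -(R : ℝ) ≤ α.snd i := (hz3 i).trans (hz2 i)
    have h2 : (0 : ℝ) ≤ R := R.2
    change max _ (min _ _) = min (α.snd i) (R : ℝ)
    rw [max_eq_right (le_min (by linarith) h1), min_comm]

/-- The product `s • α` of a real number and an interval vector. -/
def scale {ι : Type*} (s : ℝ) (α : Box ι) : Box ι :=
  ⟨(fun i => min (s * α.fst i) (s * α.snd i), fun i => max (s * α.fst i) (s * α.snd i)),
    fun _ => min_le_max⟩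

/-- The product of an interval matrix and an interval vector, in interval arithmetic. -/
def matVec {n : ℕ} (A : Box (Fin n × Fin n)) (v : Box (Fin n)) : Box (Fin n) :=
  ⟨(fun i => ∑ j, min (min (A.fst (i, j) * v.fst j) (A.fst (i, j) * v.snd j))
        (min (A.snd (i, j) * v.fst j) (A.snd (i, j) * v.snd j)),
    fun i => ∑ j, max (max (A.fst (i, j) * v.fst j) (A.fst (i, j) * v.snd j))
        (max (A.snd (i, j) * v.fst j) (A.snd (i, j) * v.snd j))),
    fun i => by
      dsimp only
      exact Finset.sum_le_sum fun j _ => (min_le_left _ _).trans ((min_le_left _ _).trans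
        ((le_max_left _ _).trans (le_max_left _ _)))⟩

/-- The integral over `[c, d]` of an interval-vector valued function, taken bound by bound. -/
noncomputable def boxIntegral {ι : Type*} (g : ℝ → Box ι) (c d : ℝ) (hcd : c ≤ d)
    (h₁ : ∀ i, IntervalIntegrable (fun t => (g t).fst i) MeasureTheory.volume c d)
    (h₂ : ∀ i, IntervalIntegrable (fun t => (g t).snd i) MeasureTheory.volume c d) : Box ι :=
  ⟨(fun i => ∫ t in c..d, (g t).fst i, fun i => ∫ t in c..d, (g t).snd i), fun i =>
    intervalIntegral.integral_mono hcd (h₁ i) (h₂ i) fun t => (g t).fst_le_snd i⟩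

/-- `α + ∫_s^x (v + (t - s) w) dt`, in interval arithmetic. -/
noncomputable def eulerStep {ι : Type*} (α v w : Box ι) (s x : ℝ) (h : s ≤ x) : Box ι :=
  α + boxIntegral (fun t => v + scale (t - s) w) s x h
    (fun i => Continuous.intervalIntegrable (by
      change Continuous fun t => v.fst i + min ((t - s) * w.fst i) ((t - s) * w.snd i)
      fun_prop) _ _)
    (fun i => Continuous.intervalIntegrable (by
      change Continuous fun t => v.snd i + max ((t - s) * w.fst i) ((t - s) * w.snd i)
      fun_prop) _ _)

/-! ### Canonical extensions, the `L̄`-derivative, and the domains `V¹` and `V¹_f` -/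

/-- The smallest hyper-rectangle which contains `S` (all of `ℝ^ι` if there is none). -/
def boxHull {ι : Type*} (S : Set (ι → ℝ)) : Set (ι → ℝ) :=
  ⋂₀ {T | (∃ β : Box ι, T = β) ∧ S ⊆ T}

/-- The canonical extension `If` of a set-valued map on the cube: the infimum (in the reverse
inclusion order) of the hyper-rectangular hulls of `f x`, for `x` in the given hyper-rectangle. -/
def canonicalExt {ι κ : Type*} {R : ℝ≥0} (f : Cube ι R → Set (κ → ℝ)) (α : IDom ι R) :
    Set (κ → ℝ) :=
  boxHull (⋃ x ∈ {x : Cube ι R | (x : ι → ℝ) ∈ α.1}, f x)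

/-- The `L̄`-derivative of `h : [-R, R]^ι → ℝ` at `x`: the supremum, i.e. the intersection, of the
hyper-rectangles `b` for which there is an open `O ∋ x` of `[-R, R]^ι` with
`h y - h z ∈ b · (y - z)` for all `y, z ∈ O`.  It is all of `ℝ^ι` if there is no such `b`. -/
def LBar {ι : Type*} [Fintype ι] {R : ℝ≥0} (h : Cube ι R → ℝ) (x : Cube ι R) : Set (ι → ℝ) :=
  ⋂₀ {T | ∃ b : Box ι, T = b ∧ ∃ O : Set (Cube ι R), IsOpen O ∧ x ∈ O ∧
    ∀ y ∈ O, ∀ z ∈ O, ∃ c ∈ b, h y - h z = ∑ i, c i * ((y : ι → ℝ) i - (z : ι → ℝ) i)}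

/-- The `L̄`-derivative of a vector-valued map: the interval matrix whose rows are the
`L̄`-derivatives of the components. -/
def LBarMat {n : ℕ} {R L : ℝ≥0} (h : Cube (Fin n) R → Cube (Fin n) L) (x : Cube (Fin n) R) :
    Set (Fin n × Fin n → ℝ) :=
  {A | ∀ i, (fun j => A (i, j)) ∈ LBar (fun y => (h y : Fin n → ℝ) i) x}

/-- `u ⊑ I(h)` and `u' ⊑ I(L̄(h))`. -/
def Approximates {n : ℕ} {K M M₁ : ℝ≥0} (u : IDom (Fin n) K → IDom (Fin n) M)
    (u' : IDom (Fin n) K → IDom (Fin n × Fin n) M₁) (h : Cube (Fin n) K → Cube (Fin n) M) : Prop :=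
  (∀ α, canonicalExt (fun x => {(h x : Fin n → ℝ)}) α ⊆ (u α).1) ∧
  ∀ α, canonicalExt (LBarMat h) α ⊆ (u' α).1

/-- `V¹`: the consistent pairs of Scott-continuous maps. -/
def V1 (n : ℕ) (K M M₁ : ℝ≥0) :
    Set ((IDom (Fin n) K → IDom (Fin n) M) × (IDom (Fin n) K → IDom (Fin n × Fin n) M₁)) :=
  {p | ScottContinuous p.1 ∧ ScottContinuous p.2 ∧
    ∃ h : Cube (Fin n) K → Cube (Fin n) M, Approximates p.1 p.2 h}

/-- `V¹_f`: the pairs in `V¹` which approximate `f` and its `L̄`-derivative. -/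
def V1f {n : ℕ} {K M : ℝ≥0} (M₁ : ℝ≥0) (f : Cube (Fin n) K → Cube (Fin n) M) :
    Set ((IDom (Fin n) K → IDom (Fin n) M) × (IDom (Fin n) K → IDom (Fin n × Fin n) M₁)) :=
  {p | p ∈ V1 n K M M₁ ∧ Approximates p.1 p.2 f}

/-! ### The domain `W_D` of the rational upper limit topology -/

/-- The sets `(p, q] ∩ [0, a]` with rational `p, q`. -/
def ratIocs (a : ℚ) : Set (Set (Set.Icc (0 : ℝ) a)) :=
  {O | ∃ p q : ℚ, O = {t : Set.Icc (0 : ℝ) a | (p : ℝ) < t ∧ (t : ℝ) ≤ q}}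

theorem wayBelow_of_lt {ι : Type*} [Finite ι] {R : ℝ≥0} {α β : IDom ι R}
    (h : ∀ i, (α.1.fst i = -(R : ℝ) ∨ α.1.fst i < β.1.fst i) ∧
      (α.1.snd i = R ∨ β.1.snd i < α.1.snd i)) : WayBelow α β := by
  intro S hS hd s hs hβs
  have hS' : ∀ α : IDom ι R, ∀ i, -(R : ℝ) ≤ α.1.fst i ∧ α.1.snd i ≤ R := fun α =>
    (box_subset_cube_iff _).1 α.2
  have h1 : ∀ i, ∃ γ ∈ S, α.1.fst i ≤ γ.1.fst i := by
    intro i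
    by_contra! hc
    have hlt : α.1.fst i ≠ -(R : ℝ) := fun e => by
      obtain ⟨γ, hγ⟩ := hS
      have := hc γ hγ
      linarith [(hS' γ i).1]
    have hlt' := ((h i).1.resolve_left hlt).trans_le (IDom.le_iff.1 hβs i).1
    classical
    -- Lower the `i`-th lower bound of `s` to that of `α`
    have hmin : ∀ γ ∈ S, γ ≤ (⟨⟨(Function.update s.1.fst i (α.1.fst i), s.1.snd), fun j => by
        change Function.update s.1.fst i (α.1.fst i) j ≤ s.1.snd j
        by_cases hj : j = i
        · subst hj; simpa using hlt'.le.trans (s.1.fst_le_snd j)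
        · simpa [hj] using s.1.fst_le_snd j⟩, by
        rw [box_subset_cube_iff]
        intro j
        refine ⟨?_, (hS' s j).2⟩
        change _ ≤ Function.update s.1.fst i (α.1.fst i) j
        by_cases hj : j = i
        · subst hj; simpa using (hS' α j).1
        · simpa [hj] using (hS' s j).1⟩ : IDom ι R) := by
      intro γ hγ
      rw [IDom.le_iff]
      intro j
      refine ⟨?_, (IDom.le_iff.1 (hs.1 hγ) j).2⟩
      change _ ≤ Function.update s.1.fst i (α.1.fst i) j
      by_cases hj : j = i
      · subst hj; simpa using (hc γ hγ).le
      · simpa [hj] using (IDom.le_iff.1 (hs.1 hγ) j).1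
    have := (IDom.le_iff.1 (hs.2 hmin) i).1
    change _ ≤ Function.update s.1.fst i (α.1.fst i) i at this
    simp only [Function.update_self] at this
    linarith
  have h2 : ∀ i, ∃ γ ∈ S, γ.1.snd i ≤ α.1.snd i := by
    intro i
    by_contra! hc
    have hlt : α.1.snd i ≠ R := fun e => by
      obtain ⟨γ, hγ⟩ := hS
      have := hc γ hγ
      linarith [(hS' γ i).2]
    have hlt' := (IDom.le_iff.1 hβs i).2.trans_lt ((h i).2.resolve_left hlt)
    classical
    -- Raise the `i`-th upper bound of `s` to that of `α`
    have hmin : ∀ γ ∈ S, γ ≤ (⟨⟨(s.1.fst, Function.update s.1.snd i (α.1.snd i)), fun j => by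
        change s.1.fst j ≤ Function.update s.1.snd i (α.1.snd i) j
        by_cases hj : j = i
        · subst hj; simpa using (s.1.fst_le_snd j).trans hlt'.le
        · simpa [hj] using s.1.fst_le_snd j⟩, by
        rw [box_subset_cube_iff]
        intro j
        refine ⟨(hS' s j).1, ?_⟩
        change Function.update s.1.snd i (α.1.snd i) j ≤ _
        by_cases hj : j = i
        · subst hj; simpa using (hS' α j).2
        · simpa [hj] using (hS' s j).2⟩ : IDom ι R) := by
      intro γ hγ
      rw [IDom.le_iff]
      intro j
      refine ⟨(IDom.le_iff.1 (hs.1 hγ) j).1, ?_⟩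
      change Function.update s.1.snd i (α.1.snd i) j ≤ _
      by_cases hj : j = i
      · subst hj; simpa using (hc γ hγ).le
      · simpa [hj] using (IDom.le_iff.1 (hs.1 hγ) j).2
    have := (IDom.le_iff.1 (hs.2 hmin) i).2
    change Function.update s.1.snd i (α.1.snd i) i ≤ _ at this
    simp only [Function.update_self] at this
    linarith
  choose γ₁ hγ₁ hle₁ using h1
  choose γ₂ hγ₂ hle₂ using h2
  have hub : ∀ T : Set (IDom ι R), T.Finite → T ⊆ S → ∃ d ∈ S, ∀ γ ∈ T, γ ≤ d := by
    intro T hT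
    induction T, hT using Set.Finite.induction_on with
    | empty => exact fun _ => ⟨hS.some, hS.some_mem, by simp⟩
    | @insert γ T _ _ ih =>
      intro hTS
      rw [Set.insert_subset_iff] at hTS
      obtain ⟨d, hdS, h1⟩ := ih hTS.2
      obtain ⟨e, he, hγe, hde⟩ := hd γ hTS.1 d hdS
      refine ⟨e, he, fun δ hδ => ?_⟩
      rcases hδ with rfl | hδ
      · exact hγe
      · exact (h1 δ hδ).trans hde
  obtain ⟨d, hdS, hub⟩ := hub (Set.range γ₁ ∪ Set.range γ₂)
    ((Set.finite_range _).union (Set.finite_range _))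
    (Set.union_subset (by rintro _ ⟨i, rfl⟩; exact hγ₁ i) (by rintro _ ⟨i, rfl⟩; exact hγ₂ i))
  refine ⟨d, hdS, IDom.le_iff.2 fun i => ⟨?_, ?_⟩⟩
  · exact (hle₁ i).trans (IDom.le_iff.1 (hub _ (Or.inl ⟨i, rfl⟩)) i).1
  · exact (IDom.le_iff.1 (hub _ (Or.inr ⟨i, rfl⟩)) i).2.trans (hle₂ i)

theorem WayBelow.lt {ι : Type*} {R : ℝ≥0} {α β : IDom ι R} (h : WayBelow α β) (i : ι) :
    (α.1.fst i = -(R : ℝ) ∨ α.1.fst i < β.1.fst i) ∧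
      (α.1.snd i = R ∨ β.1.snd i < α.1.snd i) := by
  have hS' : ∀ α : IDom ι R, ∀ i, -(R : ℝ) ≤ α.1.fst i ∧ α.1.snd i ≤ R := fun α =>
    (box_subset_cube_iff _).1 α.2
  have hclamp : ∀ x : ℝ, -(R : ℝ) ≤ x → x ≤ R → ∀ r : ℝ≥0,
      clampReal R (x - r) ≤ x ∧ x ≤ clampReal R (x + r) := by
    intro x h1 h2 r
    have hr : (0 : ℝ) ≤ r := r.2
    exact ⟨max_le h1 ((min_le_right _ _).trans (by linarith)),
      (le_min h2 (by linarith)).trans (le_max_right _ _)⟩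
  obtain ⟨_, ⟨r, hr, rfl⟩, hle⟩ := h ((fun r : ℝ≥0 => trunc R (expand β.1 r)) '' {r | 0 < r})
    ⟨_, 1, Set.mem_ofPred.2 one_pos, rfl⟩
    (by
      rintro _ ⟨r, hr, rfl⟩ _ ⟨r', hr', rfl⟩
      have hmono : ∀ r r' : ℝ≥0, r ≤ r' →
          trunc R (expand β.1 r') ≤ trunc R (expand β.1 r) := by
        intro r r' hrr'
        have : (r : ℝ) ≤ r' := hrr'
        exact IDom.le_iff.2 fun i => ⟨max_le_max le_rfl (min_le_min le_rfl (by
          change β.1.fst i - r' ≤ β.1.fst i - r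
          linarith)), max_le_max le_rfl (min_le_min le_rfl (by
          change β.1.snd i + r ≤ β.1.snd i + r'
          linarith))⟩
      exact ⟨_, ⟨min r r', Set.mem_ofPred.2 (lt_min hr hr'), rfl⟩, hmono _ _ (min_le_left _ _),
        hmono _ _ (min_le_right _ _)⟩)
    β
    (by
      constructor
      · rintro _ ⟨r, hr, rfl⟩
        refine IDom.le_iff.2 fun i => ?_
        exact ⟨(hclamp _ (hS' β i).1 ((β.1.fst_le_snd i).trans (hS' β i).2) r).1,
          (hclamp _ ((hS' β i).1.trans (β.1.fst_le_snd i)) (hS' β i).2 r).2⟩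
      · intro γ hγ
        refine IDom.le_iff.2 fun i => ⟨le_of_forall_pos_le_add fun ε hε => ?_,
          le_of_forall_pos_le_add fun ε hε => ?_⟩
        · have h1 : clampReal R (β.1.fst i - ε) ≤ γ.1.fst i :=
            (IDom.le_iff.1 (hγ ⟨⟨ε, hε.le⟩, hε, rfl⟩) i).1
          have h2 : min (R : ℝ) (β.1.fst i - ε) ≤ γ.1.fst i := (le_max_right _ _).trans h1
          rw [min_eq_right (by linarith [(β.1.fst_le_snd i : β.1.fst i ≤ β.1.snd i),
            (hS' β i).2])] at h2
          linarith
        · have h1 : γ.1.snd i ≤ clampReal R (β.1.snd i + ε) :=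
            (IDom.le_iff.1 (hγ ⟨⟨ε, hε.le⟩, hε, rfl⟩) i).2
          refine h1.trans (max_le ?_ (min_le_right _ _))
          linarith [(β.1.fst_le_snd i : β.1.fst i ≤ β.1.snd i), (hS' β i).1])
    le_rfl
  have hr' : (0 : ℝ) < r := hr
  have h1 : α.1.fst i ≤ max (-(R : ℝ)) (min (R : ℝ) (β.1.fst i - r)) := (IDom.le_iff.1 hle i).1
  have h2 : max (-(R : ℝ)) (min (R : ℝ) (β.1.snd i + r)) ≤ α.1.snd i := (IDom.le_iff.1 hle i).2
  constructor
  · rcases le_max_iff.1 h1 with h1 | h1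
    · exact Or.inl (le_antisymm h1 (hS' α i).1)
    · exact Or.inr (by linarith [min_le_right (R : ℝ) (β.1.fst i - r)])
  · have h3 := (le_max_right _ _).trans h2
    rcases min_le_iff.1 h3 with h3 | h3
    · exact Or.inl (le_antisymm (hS' α i).2 h3)
    · exact Or.inr (by linarith)

theorem goodBases (n : ℕ) (K : ℚ≥0) (a : ℚ) :
    GoodBases (ratIocs a) (ratBoxes (Fin n) (K : ℝ≥0)) where
  univ_mem := by
    refine ⟨-1, a, ?_⟩
    ext t
    have h1 := t.2.1
    have h2 := t.2.2
    simp only [Set.mem_univ, Set.mem_ofPred_eq, true_iff]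
    push_cast
    exact ⟨by linarith, h2⟩
  inter_mem := by
    rintro _ ⟨p, q, rfl⟩ _ ⟨p', q', rfl⟩
    refine ⟨max p p', min q q', ?_⟩
    ext t
    simp only [Set.mem_inter_iff, Set.mem_ofPred_eq, Rat.cast_max, Rat.cast_min, max_lt_iff,
      le_min_iff]
    tauto
  exists_lub T _ h := IDom.exists_isLUB_of_bddAbove T h
  interpolate := by
    intro x y z hx hy
    have hK : ((K : ℝ≥0) : ℝ) = ((K : ℚ) : ℝ) := by
      rw [show ((K : ℝ≥0) : ℝ) = (K : ℝ) from rfl]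
      norm_cast
    have hS' : ∀ α : IDom (Fin n) (K : ℝ≥0), ∀ i,
        -((K : ℝ≥0) : ℝ) ≤ α.1.fst i ∧ α.1.snd i ≤ ((K : ℝ≥0) : ℝ) := fun α =>
      (box_subset_cube_iff _).1 α.2
    have hlo : ∀ i, ∃ p : ℚ, -((K : ℝ≥0) : ℝ) ≤ p ∧
        (x.1.fst i = -((K : ℝ≥0) : ℝ) ∨ x.1.fst i < p) ∧
        (y.1.fst i = -((K : ℝ≥0) : ℝ) ∨ y.1.fst i < p) ∧
        ((p : ℝ) = -((K : ℝ≥0) : ℝ) ∨ (p : ℝ) < z.1.fst i) := by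
      intro i
      by_cases h : x.1.fst i = -((K : ℝ≥0) : ℝ) ∧ y.1.fst i = -((K : ℝ≥0) : ℝ)
      · refine ⟨-K, ?_, Or.inl h.1, Or.inl h.2, Or.inl ?_⟩
        · rw [hK]; push_cast; exact le_rfl
        · rw [hK]; push_cast; rfl
      · have hz : max (x.1.fst i) (y.1.fst i) < z.1.fst i := by
          have h1 := IDom.le_iff.1 hx.le i
          have h2 := IDom.le_iff.1 hy.le i
          rcases (hx.lt i).1 with e1 | e1 <;> rcases (hy.lt i).1 with e2 | e2
          · exact absurd ⟨e1, e2⟩ h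
          · exact max_lt (by linarith [(hS' y i).1]) e2
          · exact max_lt e1 (by linarith [(hS' x i).1])
          · exact max_lt e1 e2
        obtain ⟨p, hp1, hp2⟩ := exists_rat_btwn hz
        rw [max_lt_iff] at hp1
        exact ⟨p, by linarith [(hS' x i).1, hp1.1], Or.inr hp1.1, Or.inr hp1.2, Or.inr hp2⟩
    have hhi : ∀ i, ∃ q : ℚ, (q : ℝ) ≤ ((K : ℝ≥0) : ℝ) ∧
        (x.1.snd i = ((K : ℝ≥0) : ℝ) ∨ q < x.1.snd i) ∧
        (y.1.snd i = ((K : ℝ≥0) : ℝ) ∨ q < y.1.snd i) ∧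
        ((q : ℝ) = ((K : ℝ≥0) : ℝ) ∨ z.1.snd i < (q : ℝ)) := by
      intro i
      by_cases h : x.1.snd i = ((K : ℝ≥0) : ℝ) ∧ y.1.snd i = ((K : ℝ≥0) : ℝ)
      · refine ⟨K, ?_, Or.inl h.1, Or.inl h.2, Or.inl ?_⟩
        · rw [hK]
        · rw [hK]
      · have hz : z.1.snd i < min (x.1.snd i) (y.1.snd i) := by
          rcases (hx.lt i).2 with e1 | e1 <;> rcases (hy.lt i).2 with e2 | e2
          · exact absurd ⟨e1, e2⟩ h
          · exact lt_min (by linarith [(hS' y i).2]) e2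
          · exact lt_min e1 (by linarith [(hS' x i).2])
          · exact lt_min e1 e2
        obtain ⟨p, hp1, hp2⟩ := exists_rat_btwn hz
        rw [lt_min_iff] at hp2
        exact ⟨p, by linarith [(hS' x i).2, hp2.1], Or.inr hp2.1, Or.inr hp2.2, Or.inr hp1⟩
    choose p hp0 hp1 hp2 hp3 using hlo
    choose q hq0 hq1 hq2 hq3 using hhi
    have hpq : ∀ i, (p i : ℝ) ≤ z.1.fst i ∧ z.1.snd i ≤ q i := fun i => by
      constructor
      · rcases hp3 i with e | e
        · rw [e]; exact (hS' z i).1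
        · exact e.le
      · rcases hq3 i with e | e
        · rw [e]; exact (hS' z i).2
        · exact e.le
    let b : IDom (Fin n) (K : ℝ≥0) := ⟨⟨(fun i => (p i : ℝ), fun i => (q i : ℝ)), fun i =>
      (hpq i).1.trans ((z.1.fst_le_snd i).trans (hpq i).2)⟩,
      (box_subset_cube_iff _).2 fun i => ⟨hp0 i, hq0 i⟩⟩
    exact ⟨b, fun i => ⟨p i, q i, rfl, rfl⟩, wayBelow_of_lt fun i => ⟨hp1 i, hq1 i⟩,
      wayBelow_of_lt fun i => ⟨hp2 i, hq2 i⟩, wayBelow_of_lt fun i => ⟨hp3 i, hq3 i⟩⟩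

/-- The abstract basis of step functions `[0, a] → I[-K, K]^n`. -/
abbrev BaseD (n : ℕ) (K : ℚ≥0) (a : ℚ) : Type :=
  StepFun (ratIocs a) (ratBoxes (Fin n) (K : ℝ≥0))

/-- The domain `W_D`: the rounded ideal completion of the abstract basis of step functions. -/
abbrev WD (n : ℕ) (K : ℚ≥0) (a : ℚ) : Type :=
  RoundedIdeal (StepSep (BX := ratIocs a) (BD := ratBoxes (Fin n) (K : ℝ≥0)))

instance (n : ℕ) (K : ℚ≥0) (a : ℚ) : OrderBot (WD n K a) where
  bot := lowerStar (goodBases n K a) (fun _ => ⊥)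
  bot_le := lowerStar_bot_le _

/-- `f_*`, for an enclosure `f : [0, a] → I[-K, K]^n`. -/
def lower {n : ℕ} {K : ℚ≥0} {a : ℚ} (f : Set.Icc (0 : ℝ) a → IDom (Fin n) (K : ℝ≥0)) : WD n K a :=
  lowerStar (goodBases n K a) f

theorem exists_upper {n : ℕ} {K : ℚ≥0} {a : ℚ} (φ : WD n K a) :
    ∃ g : Set.Icc (0 : ℝ) a → IDom (Fin n) (K : ℝ≥0), IsLUB (StepFun.toFun '' φ.carrier) g := by
  have h : ∀ t, ∃ γ, IsLUB ((fun b : BaseD n K a => b.1 t) '' φ.carrier) γ := by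
    intro t
    refine IDom.exists_isLUB_of_directed _ ?_
    rintro _ ⟨b, hb, rfl⟩ _ ⟨b', hb', rfl⟩
    classical
    obtain ⟨z, hz, h⟩ := φ.directed {b, b'} (by
      intro x hx
      simp only [Finset.coe_insert, Finset.coe_singleton, Set.mem_insert_iff,
        Set.mem_singleton_iff] at hx
      rcases hx with rfl | rfl <;> assumption)
    exact ⟨_, ⟨z, hz, rfl⟩, ((stepSep_iff _ _).1 (h b (by simp)) t).le,
      ((stepSep_iff _ _).1 (h b' (by simp)) t).le⟩
  choose g hg using h
  refine ⟨g, isLUB_pi.2 fun t => ?_⟩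
  rw [← Set.image_comp]
  exact hg t

/-- `φ^*`, the (pointwise) supremum of the step functions in `φ`. -/
noncomputable def upper {n : ℕ} {K : ℚ≥0} {a : ℚ} (φ : WD n K a) :
    Set.Icc (0 : ℝ) a → IDom (Fin n) (K : ℝ≥0) :=
  (exists_upper φ).choose

/-! ### Partitions and the Euler operators -/

/-- Rational partitions `0 = q₀ < ⋯ < q_k = a` with `k ≥ 1`. -/
structure RatPartition (a : ℚ) where
  k : ℕ
  one_le : 1 ≤ k
  q : Fin (k + 1) → ℚ
  q_zero : q 0 = 0
  q_last : q (Fin.last k) = a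
  strictMono : StrictMono q

namespace RatPartition

variable {a : ℚ} (Q : RatPartition a)

/-- The norm `|Q|`. -/
def norm : ℚ :=
  Finset.univ.sup' ⟨(⟨0, Q.one_le⟩ : Fin Q.k), Finset.mem_univ _⟩
    fun j : Fin Q.k => Q.q j.succ - Q.q j.castSucc

/-- The step size `Δ_j = q_{j+1} - q_j`, a non-negative number. -/
def step (j : Fin Q.k) : ℝ≥0 :=
  ⟨((Q.q j.succ - Q.q j.castSucc : ℚ) : ℝ), by
    exact_mod_cast sub_nonneg.2 (Q.strictMono.monotone j.castSucc_le_succ)⟩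

/-- The partition points, as points of `[0, a]`. -/
def node (i : Fin (Q.k + 1)) : Set.Icc (0 : ℝ) a :=
  ⟨(Q.q i : ℝ), by
    constructor
    · have := Q.strictMono.monotone (Fin.zero_le i)
      rw [Q.q_zero] at this
      exact_mod_cast this
    · have := Q.strictMono.monotone (Fin.le_last i)
      rw [Q.q_last] at this
      exact_mod_cast this⟩

theorem exists_index (x : Set.Icc (0 : ℝ) a) (hx : (x : ℝ) ≠ 0) :
    ∃ j : Fin Q.k, (Q.node j.castSucc : ℝ) < x ∧ (x : ℝ) ≤ Q.node j.succ := by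
  have hpos : (0 : ℝ) < x := lt_of_le_of_ne x.2.1 hx.symm
  by_contra! hc
  have key : ∀ i : Fin (Q.k + 1), (Q.node i : ℝ) < x := by
    intro i
    induction i using Fin.induction with
    | zero => simpa [node, Q.q_zero] using hpos
    | succ j ih => exact hc j ih
  have := key (Fin.last _)
  simp only [node, Q.q_last] at this
  exact absurd x.2.2 (not_le.2 this)

/-- For `x ∈ (0, a]`, the (unique) `j` with `q_j < x ≤ q_{j+1}`. -/
noncomputable def index (x : Set.Icc (0 : ℝ) a) (hx : (x : ℝ) ≠ 0) : Fin Q.k :=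
  (Q.exists_index x hx).choose

theorem index_le (x : Set.Icc (0 : ℝ) a) (hx : (x : ℝ) ≠ 0) :
    (Q.node (Q.index x hx).castSucc : ℝ) ≤ x :=
  (Q.exists_index x hx).choose_spec.1.le

end RatPartition

section Euler

variable {n : ℕ} {K : ℚ≥0} {a : ℚ}

/-- The point `0` of `ℝⁿ`, as an element of `I[-K, K]^n`. -/
def zeroBox (n : ℕ) (K : ℝ≥0) : IDom (Fin n) K :=
  ⟨NonemptyInterval.pure 0, (box_subset_cube_iff _).2 fun _ => by simp⟩

open Classical in
/-- The operator `Φ_{(u,u')}(Q)` on enclosures. -/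
noncomputable def Phi {M : ℚ≥0} {M₁ : ℝ≥0}
    (u : IDom (Fin n) (K : ℝ≥0) → IDom (Fin n) (M : ℝ≥0))
    (u' : IDom (Fin n) (K : ℝ≥0) → IDom (Fin n × Fin n) M₁) (Q : RatPartition a)
    (φ : Set.Icc (0 : ℝ) a → IDom (Fin n) (K : ℝ≥0)) :
    Set.Icc (0 : ℝ) a → IDom (Fin n) (K : ℝ≥0) := fun x =>
  if hx : (x : ℝ) = 0 then zeroBox n K
  else
    let j := Q.index x hx
    let α := φ (Q.node j.castSucc)
    let G := trunc (K : ℝ≥0) (expand α.1 (M * Q.step j))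
    trunc (K : ℝ≥0) (eulerStep α.1 (u α).1 (matVec (u' G).1 (u G).1)
      (Q.node j.castSucc) x (Q.index_le x hx))

/-- The operator `F_{(u,u')}(Q)` on `W_D`. -/
noncomputable def EulerF {M : ℚ≥0} {M₁ : ℝ≥0}
    (u : IDom (Fin n) (K : ℝ≥0) → IDom (Fin n) (M : ℝ≥0))
    (u' : IDom (Fin n) (K : ℝ≥0) → IDom (Fin n × Fin n) M₁) (Q : RatPartition a)
    (φ : WD n K a) : WD n K a :=
  lower (Phi u u' Q (upper φ))

open Classical in
/-- Application of `w : I[-K, K]^ι → I[-L, L]^κ` to a hyper-rectangle of `ℝ^ι`.  If the argument is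
not contained in `[-K, K]^ι`, then the application is not defined, and the value here is `0`. -/
noncomputable def applyBox {ι κ : Type*} {R L : ℝ≥0} (w : IDom ι R → IDom κ L) (α : Box ι) :
    Box κ :=
  if h : (α : Set (ι → ℝ)) ⊆ Cube ι R then (w ⟨α, h⟩).1 else NonemptyInterval.pure 0

/-- One step of the second-order Euler method, from the enclosure `α` at `q_j` to the point `x`:
`α + ∫_{q_j}^x u(α) + (t - q_j) (u' · u)(α ⊕ M Δ_j) dt`. -/
noncomputable def e2Step {M : ℚ≥0} {M₁ : ℝ≥0}
    (u : IDom (Fin n) (K : ℝ≥0) → IDom (Fin n) (M : ℝ≥0))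
    (u' : IDom (Fin n) (K : ℝ≥0) → IDom (Fin n × Fin n) M₁) (Q : RatPartition a)
    (j : Fin Q.k) (α : Box (Fin n)) (x : Set.Icc (0 : ℝ) a)
    (h : (Q.node j.castSucc : ℝ) ≤ x) : Box (Fin n) :=
  let G := expand α (M * Q.step j)
  eulerStep α (applyBox u α) (matVec (applyBox u' G) (applyBox u G)) (Q.node j.castSucc) x h

/-- The values of the second-order Euler enclosure at the partition points, by recursion. -/
noncomputable def e2Node {M : ℚ≥0} {M₁ : ℝ≥0}
    (u : IDom (Fin n) (K : ℝ≥0) → IDom (Fin n) (M : ℝ≥0))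
    (u' : IDom (Fin n) (K : ℝ≥0) → IDom (Fin n × Fin n) M₁) (Q : RatPartition a)
    (i : Fin (Q.k + 1)) : Box (Fin n) :=
  Fin.induction (motive := fun _ => Box (Fin n)) (NonemptyInterval.pure 0)
    (fun j α => e2Step u u' Q j α (Q.node j.succ)
      (by
        change ((Q.q j.castSucc : ℚ) : ℝ) ≤ ((Q.q j.succ : ℚ) : ℝ)
        exact_mod_cast Q.strictMono.monotone j.castSucc_le_succ)) i

open Classical in
/-- The second-order Euler enclosure `E²_{(u,u')}(Q)`. -/
noncomputable def E2 {M : ℚ≥0} {M₁ : ℝ≥0}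
    (u : IDom (Fin n) (K : ℝ≥0) → IDom (Fin n) (M : ℝ≥0))
    (u' : IDom (Fin n) (K : ℝ≥0) → IDom (Fin n × Fin n) M₁) (Q : RatPartition a)
    (x : Set.Icc (0 : ℝ) a) : Box (Fin n) :=
  if hx : (x : ℝ) = 0 then NonemptyInterval.pure 0
  else e2Step u u' Q (Q.index x hx) (e2Node u u' Q (Q.index x hx).castSucc) x (Q.index_le x hx)

end Euler

end EulerDomain

open EulerDomain

namespace EulerDomain

open Filter Topology

/-! ### Interval arithmetic -/

/-! The operator factors as `EulerF = lower ∘ Phi ∘ upper`, and `Phi` reads its argument only at the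
partition points q_0, …, q_{k-1}. On (q_j, q_{j+1}] every bound of its value is a clamped quadratic
polynomial in x whose coefficients depend only on φ(q_j). Hence `Phi u u' Q φ` is continuous for the
rational upper limit topology, `upper_lower` applies, and the iteration can be followed on
functions: `upper (EulerF φ) = Phi (upper φ)` (`upper_EulerF`).

A priori bound: over a step of length t ≤ 1 an enclosure grows by at most tM + (t²/2)·nM₁M ≤ tM(1 +
nM₁). So E(x) stays within radius xM(1 + nM₁), and since aM(1 + nM₁) ≤ K, both E(x) and the
expansions E(q_j) ⊕ MΔ_j lie in the cube. This gives well-definedness, and it makes the truncations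
in `Phi` harmless on correct data (`Phi_eq_E2`). Each application of the operator makes one more
partition point correct, so the (k+1)-st iterate has upper function E, and so has the next one.
Iterates are recovered from their upper functions by `lower`, so the iteration is stationary.
Monotonicity then turns the stationary value into the least fixpoint and the supremum of the
iterates.

Scott continuity: along a directed family with supremum φ, the bounds at the partition points
converge. Scott-continuous `u`, `u'` and the interval operations preserve this convergence. Since
there are finitely many partition points and steps have length at most one, `Phi` converges
uniformly in x. Separation of step functions leaves a uniform gap (`StepSep.exists_gap`), so a step
function separated from one below the limit already lies below `Phi` of some member of the family
(`exists_le_Phi_upper`). -/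

theorem min_mul_le_mul {x₁ x₂ x : ℝ} (h₁ : x₁ ≤ x) (h₂ : x ≤ x₂) (y : ℝ) :
    min (x₁ * y) (x₂ * y) ≤ x * y := by
  rcases le_total 0 y with hy | hy
  · exact (min_le_left _ _).trans (mul_le_mul_of_nonneg_right h₁ hy)
  · exact (min_le_right _ _).trans (mul_le_mul_of_nonpos_right h₂ hy)

theorem mul_le_max_mul {x₁ x₂ x : ℝ} (h₁ : x₁ ≤ x) (h₂ : x ≤ x₂) (y : ℝ) :
    x * y ≤ max (x₁ * y) (x₂ * y) := by
  rcases le_total 0 y with hy | hy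
  · exact (mul_le_mul_of_nonneg_right h₂ hy).trans (le_max_right _ _)
  · exact (mul_le_mul_of_nonpos_right h₁ hy).trans (le_max_left _ _)

/-- A product is affine in each factor separately, so its extrema over a rectangle occur at corners;
the one-variable bound is used once per factor. -/
theorem min_corners_le {x₁ x₂ y₁ y₂ x y : ℝ} (hx₁ : x₁ ≤ x) (hx₂ : x ≤ x₂) (hy₁ : y₁ ≤ y)
    (hy₂ : y ≤ y₂) :
    min (min (x₁ * y₁) (x₁ * y₂)) (min (x₂ * y₁) (x₂ * y₂)) ≤ x * y := by
  have h : ∀ z, min (z * y₁) (z * y₂) ≤ z * y := fun z => by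
    simpa only [mul_comm z] using min_mul_le_mul hy₁ hy₂ z
  exact (min_le_min (h x₁) (h x₂)).trans (min_mul_le_mul hx₁ hx₂ y)

theorem le_max_corners {x₁ x₂ y₁ y₂ x y : ℝ} (hx₁ : x₁ ≤ x) (hx₂ : x ≤ x₂) (hy₁ : y₁ ≤ y)
    (hy₂ : y ≤ y₂) :
    x * y ≤ max (max (x₁ * y₁) (x₁ * y₂)) (max (x₂ * y₁) (x₂ * y₂)) := by
  have h : ∀ z, z * y ≤ max (z * y₁) (z * y₂) := fun z => by
    simpa only [mul_comm z] using mul_le_max_mul hy₁ hy₂ z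
  exact (mul_le_max_mul hx₁ hx₂ y).trans (max_le_max (h x₁) (h x₂))

theorem matVec_fst {n : ℕ} (A : Box (Fin n × Fin n)) (v : Box (Fin n)) (i : Fin n) :
    (matVec A v).fst i = ∑ j, min (min (A.fst (i, j) * v.fst j) (A.fst (i, j) * v.snd j))
      (min (A.snd (i, j) * v.fst j) (A.snd (i, j) * v.snd j)) := rfl

theorem matVec_snd {n : ℕ} (A : Box (Fin n × Fin n)) (v : Box (Fin n)) (i : Fin n) :
    (matVec A v).snd i = ∑ j, max (max (A.fst (i, j) * v.fst j) (A.fst (i, j) * v.snd j))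
      (max (A.snd (i, j) * v.fst j) (A.snd (i, j) * v.snd j)) := rfl

/-- The order here is inclusion, the reverse of the order of `IDom`. Every corner product of the
smaller data is a product of points of the larger data, hence lies between the extreme corner
products of the latter. -/
theorem matVec_mono {n : ℕ} {A A' : Box (Fin n × Fin n)} {v v' : Box (Fin n)} (hA : A ≤ A')
    (hv : v ≤ v') : matVec A v ≤ matVec A' v' := by
  rw [NonemptyInterval.le_def] at hA hv ⊢
  have hAA : ∀ p, A.fst p ≤ A.snd p := A.fst_le_snd
  have hvv : ∀ p, v.fst p ≤ v.snd p := v.fst_le_snd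
  have hA₁ : ∀ p, A'.fst p ≤ A.snd p := fun p => (hA.1 p).trans (hAA p)
  have hA₂ : ∀ p, A.fst p ≤ A'.snd p := fun p => (hAA p).trans (hA.2 p)
  have hv₁ : ∀ p, v'.fst p ≤ v.snd p := fun p => (hv.1 p).trans (hvv p)
  have hv₂ : ∀ p, v.fst p ≤ v'.snd p := fun p => (hvv p).trans (hv.2 p)
  refine ⟨fun i => ?_, fun i => ?_⟩
  · rw [matVec_fst, matVec_fst]
    exact Finset.sum_le_sum fun j _ => le_min
      (le_min (min_corners_le (hA.1 _) (hA₂ _) (hv.1 _) (hv₂ _))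
        (min_corners_le (hA.1 _) (hA₂ _) (hv₁ _) (hv.2 _)))
      (le_min (min_corners_le (hA₁ _) (hA.2 _) (hv.1 _) (hv₂ _))
        (min_corners_le (hA₁ _) (hA.2 _) (hv₁ _) (hv.2 _)))
  · rw [matVec_snd, matVec_snd]
    exact Finset.sum_le_sum fun j _ => max_le
      (max_le (le_max_corners (hA.1 _) (hA₂ _) (hv.1 _) (hv₂ _))
        (le_max_corners (hA.1 _) (hA₂ _) (hv₁ _) (hv.2 _)))
      (max_le (le_max_corners (hA₁ _) (hA.2 _) (hv.1 _) (hv₂ _))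
        (le_max_corners (hA₁ _) (hA.2 _) (hv₁ _) (hv.2 _)))

/-- All coordinates of the hyper-rectangle `α` lie in `[-r, r]`. -/
def BoundedBy {ι : Type*} (α : Box ι) (r : ℝ) : Prop :=
  ∀ i, -r ≤ α.fst i ∧ α.snd i ≤ r

theorem BoundedBy.abs_fst {ι : Type*} {α : Box ι} {r : ℝ} (h : BoundedBy α r) (i : ι) :
    |α.fst i| ≤ r :=
  abs_le.2 ⟨(h i).1, (α.fst_le_snd i).trans (h i).2⟩

theorem BoundedBy.abs_snd {ι : Type*} {α : Box ι} {r : ℝ} (h : BoundedBy α r) (i : ι) :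
    |α.snd i| ≤ r :=
  abs_le.2 ⟨(h i).1.trans (α.fst_le_snd i), (h i).2⟩

theorem IDom.box_injective {ι : Type*} {R : ℝ≥0} :
    Function.Injective (IDom.box (ι := ι) (R := R)) := by
  rintro ⟨_, _⟩ ⟨_, _⟩ h
  cases h
  rfl

theorem IDom.boundedBy {ι : Type*} {R : ℝ≥0} (α : IDom ι R) : BoundedBy α.1 R :=
  (box_subset_cube_iff _).1 α.2

theorem BoundedBy.matVec {n : ℕ} {A : Box (Fin n × Fin n)} {v : Box (Fin n)} {r s : ℝ}
    (hA : BoundedBy A r) (hv : BoundedBy v s) (hr : 0 ≤ r) : BoundedBy (matVec A v) (n * (r * s)) := by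
  have key : ∀ x y : ℝ, |x| ≤ r → |y| ≤ s → -(r * s) ≤ x * y ∧ x * y ≤ r * s := fun x y hx hy => by
    rw [← abs_le, abs_mul]
    exact mul_le_mul hx hy (abs_nonneg _) hr
  intro i
  constructor
  · rw [show -((n : ℝ) * (r * s)) = ∑ _j : Fin n, -(r * s) by simp, matVec_fst]
    exact Finset.sum_le_sum fun j _ => le_min
      (le_min (key _ _ (hA.abs_fst _) (hv.abs_fst _)).1 (key _ _ (hA.abs_fst _) (hv.abs_snd _)).1)
      (le_min (key _ _ (hA.abs_snd _) (hv.abs_fst _)).1 (key _ _ (hA.abs_snd _) (hv.abs_snd _)).1)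
  · rw [show (n : ℝ) * (r * s) = ∑ _j : Fin n, r * s by simp, matVec_snd]
    exact Finset.sum_le_sum fun j _ => max_le
      (max_le (key _ _ (hA.abs_fst _) (hv.abs_fst _)).2 (key _ _ (hA.abs_fst _) (hv.abs_snd _)).2)
      (max_le (key _ _ (hA.abs_snd _) (hv.abs_fst _)).2 (key _ _ (hA.abs_snd _) (hv.abs_snd _)).2)

theorem integral_add_sub_mul (s x v w : ℝ) :
    ∫ t in s..x, (v + (t - s) * w) = (x - s) * v + (x - s) ^ 2 / 2 * w := by
  rw [intervalIntegral.integral_add (by simp) (Continuous.intervalIntegrable (by fun_prop) _ _),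
    intervalIntegral.integral_mul_const, intervalIntegral.integral_sub (by simp) (by simp)]
  simp only [intervalIntegral.integral_const, integral_id, smul_eq_mul]
  ring

/-- On the interval of integration t - s ≥ 0, so scaling does not exchange the two bounds of w, and
the integral has a closed form. -/
theorem eulerStep_fst {ι : Type*} (α v w : Box ι) {s x : ℝ} (h : s ≤ x) (i : ι) :
    (eulerStep α v w s x h).fst i =
      α.fst i + ((x - s) * v.fst i + (x - s) ^ 2 / 2 * w.fst i) := by
  rw [← integral_add_sub_mul]
  change α.fst i + ∫ t in s..x, (v.fst i + min ((t - s) * w.fst i) ((t - s) * w.snd i)) = _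
  congr 1
  refine intervalIntegral.integral_congr fun t ht => ?_
  rw [Set.uIcc_of_le h] at ht
  rw [min_eq_left (mul_le_mul_of_nonneg_left (w.fst_le_snd i) (sub_nonneg.2 ht.1))]

theorem eulerStep_snd {ι : Type*} (α v w : Box ι) {s x : ℝ} (h : s ≤ x) (i : ι) :
    (eulerStep α v w s x h).snd i =
      α.snd i + ((x - s) * v.snd i + (x - s) ^ 2 / 2 * w.snd i) := by
  rw [← integral_add_sub_mul]
  change α.snd i + ∫ t in s..x, (v.snd i + max ((t - s) * w.fst i) ((t - s) * w.snd i)) = _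
  congr 1
  refine intervalIntegral.integral_congr fun t ht => ?_
  rw [Set.uIcc_of_le h] at ht
  rw [max_eq_right (mul_le_mul_of_nonneg_left (w.fst_le_snd i) (sub_nonneg.2 ht.1))]

theorem eulerStep_mono {ι : Type*} {α v w α' v' w' : Box ι} (hα : α ≤ α') (hv : v ≤ v')
    (hw : w ≤ w') {s x : ℝ} (h : s ≤ x) : eulerStep α v w s x h ≤ eulerStep α' v' w' s x h := by
  rw [NonemptyInterval.le_def] at *
  have h₀ : 0 ≤ x - s := sub_nonneg.2 h
  have h₁ : 0 ≤ (x - s) ^ 2 / 2 := by positivity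
  refine ⟨fun i => ?_, fun i => ?_⟩
  · rw [eulerStep_fst, eulerStep_fst]
    exact add_le_add (hα.1 i) (add_le_add (mul_le_mul_of_nonneg_left (hv.1 i) h₀)
      (mul_le_mul_of_nonneg_left (hw.1 i) h₁))
  · rw [eulerStep_snd, eulerStep_snd]
    exact add_le_add (hα.2 i) (add_le_add (mul_le_mul_of_nonneg_left (hv.2 i) h₀)
      (mul_le_mul_of_nonneg_left (hw.2 i) h₁))

/-- A step of length t = x - s ≤ 1 satisfies t²/2 ≤ t. The quadratic contribution is thereby
absorbed into a bound linear in t, which adds up exactly over successive steps. -/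
theorem BoundedBy.eulerStep {ι : Type*} {α v w : Box ι} {r b c s x : ℝ} (hα : BoundedBy α r)
    (hv : BoundedBy v b) (hw : BoundedBy w c) (hc : 0 ≤ c) (h : s ≤ x) (h₁ : x - s ≤ 1) :
    BoundedBy (eulerStep α v w s x h) (r + (x - s) * (b + c)) := by
  have h₀ : 0 ≤ x - s := sub_nonneg.2 h
  have h₂ : (x - s) ^ 2 / 2 ≤ x - s := by nlinarith
  have h₃ : (x - s) ^ 2 / 2 * c ≤ (x - s) * c := mul_le_mul_of_nonneg_right h₂ hc
  have h₄ : 0 ≤ (x - s) ^ 2 / 2 := by positivity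
  intro i
  rw [eulerStep_fst, eulerStep_snd]
  have e₁ := mul_le_mul_of_nonneg_left (hv i).1 h₀
  have e₂ := mul_le_mul_of_nonneg_left (hv i).2 h₀
  have e₃ := mul_le_mul_of_nonneg_left (hw i).1 h₄
  have e₄ := mul_le_mul_of_nonneg_left (hw i).2 h₄
  constructor <;> linarith [(hα i).1, (hα i).2]

/-! ### Truncation and expansion of hyper-rectangles -/

theorem clampReal_mono (R : ℝ≥0) : Monotone (clampReal R) := fun _ _ h =>
  max_le_max le_rfl (min_le_min le_rfl h)

theorem clampReal_of_abs_le {R : ℝ≥0} {x : ℝ} (h : |x| ≤ R) : clampReal R x = x := by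
  rw [abs_le] at h
  rw [clampReal, min_eq_right h.2, max_eq_right h.1]

/-- One-sided form of the fact that the nearest-point projection is 1-Lipschitz; it carries error
bounds through the truncation in `phiStep`. -/
theorem clampReal_le_add {R : ℝ≥0} {x y ε : ℝ} (hε : 0 ≤ ε) (h : x ≤ y + ε) :
    clampReal R x ≤ clampReal R y + ε := by
  refine max_le ((le_max_left _ _).trans (by linarith [show clampReal R y = max _ _ from rfl]))
    ?_
  have : min (R : ℝ) x ≤ min (R : ℝ) y + ε := by
    rw [min_add]
    exact min_le_min (by linarith) h
  exact this.trans (add_le_add (le_max_right _ _) le_rfl)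

theorem continuous_clampReal (R : ℝ≥0) : Continuous (clampReal R) := by
  unfold clampReal
  fun_prop

theorem trunc_mono {ι : Type*} (R : ℝ≥0) {α β : Box ι} (h : α ≤ β) : trunc R β ≤ trunc R α := by
  rw [NonemptyInterval.le_def] at h
  exact IDom.le_iff.2 fun i => ⟨clampReal_mono R (h.1 i), clampReal_mono R (h.2 i)⟩

theorem coe_trunc_of_boundedBy {ι : Type*} {R : ℝ≥0} {α : Box ι} (h : BoundedBy α R) :
    (trunc R α).1 = α :=
  NonemptyInterval.ext (Prod.ext (funext fun i => clampReal_of_abs_le (h.abs_fst i))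
    (funext fun i => clampReal_of_abs_le (h.abs_snd i)))

theorem expand_mono {ι : Type*} {α β : Box ι} (h : α ≤ β) (r : ℝ≥0) :
    expand α r ≤ expand β r := by
  rw [NonemptyInterval.le_def] at *
  exact ⟨fun i => sub_le_sub_right (h.1 i) _, fun i => add_le_add_left (h.2 i) _⟩

theorem BoundedBy.expand {ι : Type*} {α : Box ι} {s : ℝ} (h : BoundedBy α s) (r : ℝ≥0) :
    BoundedBy (expand α r) (s + r) := fun i =>
  ⟨by change _ ≤ α.fst i - r; linarith [(h i).1], add_le_add_left (h i).2 _⟩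

theorem BoundedBy.mono {ι : Type*} {α : Box ι} {r s : ℝ} (h : BoundedBy α r) (hrs : r ≤ s) :
    BoundedBy α s := fun i =>
  ⟨(neg_le_neg hrs).trans (h i).1, (h i).2.trans hrs⟩

/-! ### Coordinatewise convergence of hyper-rectangles -/

/-- Convergence of all lower and upper bounds. -/
def BoxTendsto {J ι : Type*} (α : J → Box ι) (l : Filter J) (A : Box ι) : Prop :=
  ∀ i, Tendsto (fun j => (α j).fst i) l (𝓝 (A.fst i)) ∧
    Tendsto (fun j => (α j).snd i) l (𝓝 (A.snd i))

theorem BoxTendsto.trunc {J ι : Type*} {α : J → Box ι} {l : Filter J} {A : Box ι}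
    (h : BoxTendsto α l A) (R : ℝ≥0) :
    BoxTendsto (fun j => (trunc R (α j)).1) l (trunc R A).1 := fun i =>
  ⟨((continuous_clampReal R).tendsto _).comp (h i).1,
    ((continuous_clampReal R).tendsto _).comp (h i).2⟩

theorem BoxTendsto.expand {J ι : Type*} {α : J → Box ι} {l : Filter J} {A : Box ι}
    (h : BoxTendsto α l A) (r : ℝ≥0) :
    BoxTendsto (fun j => expand (α j) r) l (expand A r) := fun i =>
  ⟨(h i).1.sub_const _, (h i).2.add_const _⟩

theorem BoxTendsto.matVec {J : Type*} {n : ℕ} {A : J → Box (Fin n × Fin n)} {v : J → Box (Fin n)}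
    {l : Filter J} {A' : Box (Fin n × Fin n)} {v' : Box (Fin n)} (hA : BoxTendsto A l A')
    (hv : BoxTendsto v l v') :
    BoxTendsto (fun j => matVec (A j) (v j)) l (matVec A' v') := fun i =>
  ⟨tendsto_finsetSum Finset.univ fun j _ =>
    (((hA (i, j)).1.mul (hv j).1).min ((hA (i, j)).1.mul (hv j).2)).min
      (((hA (i, j)).2.mul (hv j).1).min ((hA (i, j)).2.mul (hv j).2)),
    tendsto_finsetSum Finset.univ fun j _ =>
    (((hA (i, j)).1.mul (hv j).1).max ((hA (i, j)).1.mul (hv j).2)).max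
      (((hA (i, j)).2.mul (hv j).1).max ((hA (i, j)).2.mul (hv j).2))⟩

theorem BoxTendsto.eventually_abs_sub_le {J ι : Type*} [Finite ι] {α : J → Box ι} {l : Filter J}
    {A : Box ι} (h : BoxTendsto α l A) {ε : ℝ} (hε : 0 < ε) :
    ∀ᶠ j in l, ∀ i, |(α j).fst i - A.fst i| ≤ ε ∧ |(α j).snd i - A.snd i| ≤ ε := by
  refine eventually_all.2 fun i => ?_
  filter_upwards [Metric.tendsto_nhds.1 (h i).1 ε hε, Metric.tendsto_nhds.1 (h i).2 ε hε]
    with j h₁ h₂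
  rw [Real.dist_eq] at h₁ h₂
  exact ⟨h₁.le, h₂.le⟩

/-- A one-step enclosure depends uniformly on its data, over steps of length at most one. -/
theorem BoxTendsto.eventually_eulerStep {J ι : Type*} [Finite ι] {α v w : J → Box ι}
    {l : Filter J} {A V W : Box ι} (hα : BoxTendsto α l A) (hv : BoxTendsto v l V)
    (hw : BoxTendsto w l W) {ε : ℝ} (hε : 0 < ε) :
    ∀ᶠ j in l, ∀ s x : ℝ, ∀ h : s ≤ x, x - s ≤ 1 → ∀ i,
      |(EulerDomain.eulerStep (α j) (v j) (w j) s x h).fst i -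
        (EulerDomain.eulerStep A V W s x h).fst i| ≤ ε ∧
      |(EulerDomain.eulerStep (α j) (v j) (w j) s x h).snd i -
        (EulerDomain.eulerStep A V W s x h).snd i| ≤ ε := by
  -- The base value, the first-order and the second-order term each get ε/3. The coefficients t and
  -- t²/2 are at most one, so the estimate is independent of s and x.
  have key : ∀ c d p q y z t : ℝ, 0 ≤ t → t ≤ 1 → |c - d| ≤ ε / 3 → |p - q| ≤ ε / 3 →
      |y - z| ≤ ε / 3 →
      |c + (t * p + t ^ 2 / 2 * y) - (d + (t * q + t ^ 2 / 2 * z))| ≤ ε := by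
    intro c d p q y z t h₀ h₁ hc hp hy
    have e₂ : |t * (p - q)| ≤ ε / 3 := by
      rw [abs_mul, abs_of_nonneg h₀]
      exact (mul_le_of_le_one_left (abs_nonneg _) h₁).trans hp
    have e₃ : |t ^ 2 / 2 * (y - z)| ≤ ε / 3 := by
      rw [abs_mul, abs_of_nonneg (by positivity)]
      exact (mul_le_of_le_one_left (abs_nonneg _) (by nlinarith)).trans hy
    rw [show c + (t * p + t ^ 2 / 2 * y) - (d + (t * q + t ^ 2 / 2 * z)) =
      (c - d) + t * (p - q) + t ^ 2 / 2 * (y - z) by ring]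
    refine (abs_add_three _ _ _).trans ?_
    linarith
  filter_upwards [hα.eventually_abs_sub_le (ε := ε / 3) (by positivity),
    hv.eventually_abs_sub_le (ε := ε / 3) (by positivity),
    hw.eventually_abs_sub_le (ε := ε / 3) (by positivity)] with j h₁ h₂ h₃ s x h h₄ i
  rw [eulerStep_fst, eulerStep_fst, eulerStep_snd, eulerStep_snd]
  exact ⟨key _ _ _ _ _ _ _ (sub_nonneg.2 h) h₄ (h₁ i).1 (h₂ i).1 (h₃ i).1,
    key _ _ _ _ _ _ _ (sub_nonneg.2 h) h₄ (h₁ i).2 (h₂ i).2 (h₃ i).2⟩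

theorem IDom.monotone_fst {J ι : Type*} [Preorder J] {R : ℝ≥0} {α : J → IDom ι R} (hα : Monotone α) (i : ι) :
    Monotone fun j => (α j).1.fst i := fun _ _ h => (IDom.le_iff.1 (hα h) i).1

theorem IDom.antitone_snd {J ι : Type*} [Preorder J] {R : ℝ≥0} {α : J → IDom ι R} (hα : Monotone α) (i : ι) :
    Antitone fun j => (α j).1.snd i := fun _ _ h => (IDom.le_iff.1 (hα h) i).2

section Nets

variable {J ι κ : Type*} [Preorder J] [IsDirectedOrder J] [Nonempty J] {R L : ℝ≥0}

theorem IDom.isLUB_of_boxTendsto {α : J → IDom ι R} (hα : Monotone α) {A : IDom ι R}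
    (h : BoxTendsto (fun j => (α j).1) atTop A.1) : IsLUB (Set.range α) A := by
  have h₁ := fun i => isLUB_of_tendsto_atTop (IDom.monotone_fst hα i) (h i).1
  have h₂ := fun i => isGLB_of_tendsto_atTop (IDom.antitone_snd hα i) (h i).2
  constructor
  · rintro _ ⟨j, rfl⟩
    exact IDom.le_iff.2 fun i => ⟨(h₁ i).1 ⟨j, rfl⟩, (h₂ i).1 ⟨j, rfl⟩⟩
  · intro B hB
    refine IDom.le_iff.2 fun i => ⟨(h₁ i).2 ?_, (h₂ i).2 ?_⟩ <;> rintro _ ⟨j, rfl⟩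
    · exact (IDom.le_iff.1 (hB ⟨j, rfl⟩) i).1
    · exact (IDom.le_iff.1 (hB ⟨j, rfl⟩) i).2

/-- Monotone bounded lower and upper bounds converge to their supremum and infimum. These limits
form a hyper-rectangle in the cube that is also a least upper bound, so it is `A` by uniqueness. -/
theorem IDom.boxTendsto_of_isLUB {α : J → IDom ι R} (hα : Monotone α) {A : IDom ι R}
    (h : IsLUB (Set.range α) A) : BoxTendsto (fun j => (α j).1) atTop A.1 := by
  have h₁ : ∀ i, Tendsto (fun j => (α j).1.fst i) atTop (𝓝 (⨆ j, (α j).1.fst i)) := fun i =>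
    tendsto_atTop_ciSup (IDom.monotone_fst hα i)
      ⟨R, by rintro _ ⟨j, rfl⟩; exact (abs_le.1 ((α j).boundedBy.abs_fst i)).2⟩
  have h₂ : ∀ i, Tendsto (fun j => (α j).1.snd i) atTop (𝓝 (⨅ j, (α j).1.snd i)) := fun i =>
    tendsto_atTop_ciInf (IDom.antitone_snd hα i)
      ⟨-R, by rintro _ ⟨j, rfl⟩; exact (abs_le.1 ((α j).boundedBy.abs_snd i)).1⟩
  let B : IDom ι R := ⟨⟨(fun i => ⨆ j, (α j).1.fst i, fun i => ⨅ j, (α j).1.snd i), fun i =>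
    le_of_tendsto_of_tendsto' (h₁ i) (h₂ i) fun j => (α j).1.fst_le_snd i⟩,
    (box_subset_cube_iff _).2 fun i =>
      ⟨ge_of_tendsto' (h₁ i) fun j => ((α j).boundedBy i).1,
        le_of_tendsto' (h₂ i) fun j => ((α j).boundedBy i).2⟩⟩
  have hB : BoxTendsto (fun j => (α j).1) atTop B.1 := fun i => ⟨h₁ i, h₂ i⟩
  rw [h.unique (IDom.isLUB_of_boxTendsto hα hB)]
  exact hB

/-- Along monotone nets, coordinatewise convergence and directed suprema are the same thing, so
Scott continuity becomes a limit statement that composes with ordinary continuous operations. -/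
theorem BoxTendsto.scottContinuous {g : IDom ι R → IDom κ L} (hg : ScottContinuous g)
    {α : J → IDom ι R} (hα : Monotone α) {A : IDom ι R}
    (h : BoxTendsto (fun j => (α j).1) atTop A.1) :
    BoxTendsto (fun j => (g (α j)).1) atTop (g A).1 := by
  refine IDom.boxTendsto_of_isLUB (hg.monotone.comp hα) ?_
  rw [Set.range_comp]
  exact hg (Set.range_nonempty _) hα.directed_le.directedOn_range
    (IDom.isLUB_of_boxTendsto hα h)

end Nets

/-! ### Rounded ideals of step functions -/

/-- The union of a directed family of rounded ideals. -/
def RoundedIdeal.directedSup {B : Type*} {r : B → B → Prop} (d : Set (RoundedIdeal r))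
    (hne : d.Nonempty) (hd : DirectedOn (· ≤ ·) d) : RoundedIdeal r where
  carrier := ⋃ I ∈ d, I.carrier
  nonempty := by
    obtain ⟨I, hI⟩ := hne
    obtain ⟨b, hb⟩ := I.nonempty
    exact ⟨b, Set.mem_biUnion hI hb⟩
  lower := by
    intro y hy x hxy
    simp only [Set.mem_iUnion] at hy ⊢
    obtain ⟨I, hI, hy⟩ := hy
    exact ⟨I, hI, I.lower y hy x hxy⟩
  directed := by
    classical
    intro A hA
    -- By directedness a finite subset of the union already lies in a single member, whose
    -- roundedness provides the bound.
    have key : ∃ I ∈ d, ↑A ⊆ I.carrier := by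
      induction A using Finset.induction_on with
      | empty => exact ⟨hne.some, hne.some_mem, by simp⟩
      | @insert x A _ ih =>
        rw [Finset.coe_insert, Set.insert_subset_iff] at hA
        obtain ⟨I, hI, hAI⟩ := ih hA.2
        have hx := hA.1
        simp only [Set.mem_iUnion] at hx
        obtain ⟨I', hI', hx⟩ := hx
        obtain ⟨I'', hI'', h, h'⟩ := hd I hI I' hI'
        refine ⟨I'', hI'', ?_⟩
        rw [Finset.coe_insert, Set.insert_subset_iff]
        exact ⟨h' hx, hAI.trans h⟩
    obtain ⟨I, hI, hAI⟩ := key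
    obtain ⟨z, hz, h⟩ := I.directed A hAI
    exact ⟨z, Set.mem_biUnion hI hz, h⟩

theorem RoundedIdeal.carrier_eq_of_isLUB {B : Type*} {r : B → B → Prop} {d : Set (RoundedIdeal r)}
    (hne : d.Nonempty) (hd : DirectedOn (· ≤ ·) d) {I : RoundedIdeal r} (h : IsLUB d I) :
    I.carrier = ⋃ J ∈ d, J.carrier := by
  have : IsLUB d (RoundedIdeal.directedSup d hne hd) :=
    ⟨fun J hJ => Set.subset_biUnion_of_mem (u := RoundedIdeal.carrier) hJ,
      fun J hJ => Set.iUnion₂_subset fun J' hJ' => hJ hJ'⟩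
  rw [h.unique this]
  rfl

section Step

variable {X D : Type*} [PartialOrder D] [OrderBot D] {BX : Set (Set X)} {BD : Set D}

theorem lowerStar_mono (hB : GoodBases BX BD) {f g : X → D} (h : f ≤ g) :
    lowerStar hB f ≤ lowerStar hB g := by
  rintro b ⟨θ₁, θ₂, h1, h2, h3⟩
  exact ⟨θ₁, θ₂, h1, h2, h3.trans h⟩

theorem Sep.le {f g : X → D} (h : Sep BX BD f g) : f ≤ g := by
  obtain ⟨θ₁, θ₂, h1, h2, h3⟩ := h
  rw [stepSep_iff] at h2
  exact h1.trans (le_trans (fun t => (h2 t).le) h3)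

/-- The value at t is determined by which of the finitely many sets of a presentation contain t. -/
theorem StepFun.finite_range_prod (θ η : StepFun BX BD) :
    (Set.range fun t => (θ.1 t, η.1 t)).Finite := by
  have key : ∀ θ : StepFun BX BD, (Set.range θ.1).Finite := by
    intro θ
    obtain ⟨S, hS⟩ := θ.2
    have hfin : {T | T ⊆ S}.Finite := hS.1.finite_subsets
    refine Set.Finite.subset ((hfin.biUnion (t := fun T => {d | IsLUB (Prod.snd '' T) d}) ?_)) ?_
    · intro T _
      exact Set.Subsingleton.finite fun x hx y hy => IsLUB.unique hx hy
    · rintro _ ⟨t, rfl⟩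
      exact Set.mem_biUnion (Set.sep_subset _ _) (hS.isLUB t)
  refine ((key θ).prod (key η)).subset ?_
  rintro _ ⟨t, rfl⟩
  exact ⟨⟨t, rfl⟩, ⟨t, rfl⟩⟩

/-- If `b ≪ b'` and `b' ≤ g` on the basic set `O`, then some step function in `g_*` has a value
at least `b` on `O`. -/
theorem exists_sep_of_le (hB : GoodBases BX BD) {O : Set X} (hO : O ∈ BX) {b b' : D} (hb : b ∈ BD)
    (hb' : b' ∈ BD) (h : WayBelow b b') {g : X → D} (hg : ∀ t ∈ O, b' ≤ g t) :
    ∃ θ : StepFun BX BD, Sep BX BD θ.1 g ∧ ∀ t ∈ O, b ≤ θ.1 t := by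
  obtain ⟨η, hη, hηg⟩ := exists_stepFun (BX := BX) (BD := BD) (S := {(O, b')}) hB.exists_lub
    (Set.finite_singleton _) (by simp [hO, hb']) g (by simpa using hg)
  obtain ⟨θ, hθ, -⟩ := exists_stepFun (BX := BX) (BD := BD) (S := {(O, b)}) hB.exists_lub
    (Set.finite_singleton _) (by simp [hO, hb]) g (by simpa using fun t ht => h.le.trans (hg t ht))
  refine ⟨θ, ⟨θ, η, le_rfl, ⟨_, hθ, ?_⟩, hηg⟩, fun t ht => hθ.le rfl ht⟩
  rintro _ rfl t ht
  exact h.mono le_rfl (hη.le rfl ht)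

end Step

/-- Separated step functions with values in `I[-R, R]^ι` are separated by a uniform margin. -/
theorem StepSep.exists_gap {X ι : Type*} [Finite ι] {R : ℝ≥0} {BX : Set (Set X)}
    {BD : Set (IDom ι R)} {θ η : StepFun BX BD} (h : StepSep θ η) :
    ∃ ε : ℝ, 0 < ε ∧ ∀ t i,
      ((θ.1 t).1.fst i = -(R : ℝ) ∨ (θ.1 t).1.fst i + ε ≤ (η.1 t).1.fst i) ∧
      ((θ.1 t).1.snd i = R ∨ (η.1 t).1.snd i + ε ≤ (θ.1 t).1.snd i) := by
  rw [stepSep_iff] at h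
  have key : ∀ (P : Prop) (x y : ℝ), P ∨ x < y → ∀ᶠ ε in 𝓝[>] (0 : ℝ), P ∨ x + ε ≤ y := by
    rintro P x y (hP | hxy)
    · exact Eventually.of_forall fun _ => Or.inl hP
    · filter_upwards [Ioc_mem_nhdsGT (sub_pos.2 hxy)] with ε hε
      exact Or.inr (by linarith [hε.2])
  -- Only finitely many pairs of values and finitely many coordinates occur, so one small positive ε
  -- serves for all of them.
  have hev : ∀ᶠ ε in 𝓝[>] (0 : ℝ), ∀ p ∈ Set.range fun t => (θ.1 t, η.1 t), ∀ i,
      (p.1.1.fst i = -(R : ℝ) ∨ p.1.1.fst i + ε ≤ p.2.1.fst i) ∧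
      (p.1.1.snd i = R ∨ p.2.1.snd i + ε ≤ p.1.1.snd i) := by
    refine (eventually_all_finite (StepFun.finite_range_prod θ η)).2 ?_
    rintro _ ⟨t, rfl⟩
    exact eventually_all.2 fun i => (key _ _ _ ((h t).lt i).1).and (key _ _ _ ((h t).lt i).2)
  obtain ⟨ε, h₁, h₂⟩ := (hev.and self_mem_nhdsWithin).exists
  exact ⟨ε, h₂, fun t => h₁ _ ⟨t, rfl⟩⟩

/-- After clamping, each bound either sits on the boundary of the cube, where it imposes no
constraint, or differs from that of `β` by exactly r. -/
theorem IDom.trunc_expand_wayBelow {ι : Type*} [Finite ι] {R : ℝ≥0} (β : IDom ι R) {r : ℝ≥0}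
    (hr : 0 < r) : WayBelow (trunc R (expand β.1 r)) β := by
  have hr' : (0 : ℝ) < r := hr
  refine wayBelow_of_lt fun i => ⟨?_, ?_⟩
  · change clampReal R (β.1.fst i - r) = _ ∨ clampReal R (β.1.fst i - r) < _
    have := (abs_le.1 (β.boundedBy.abs_fst i)).2
    rw [clampReal, min_eq_right (by linarith)]
    rcases le_total (β.1.fst i - r) (-(R : ℝ)) with h | h
    · exact Or.inl (max_eq_left h)
    · right
      rw [max_eq_right h]
      linarith
  · change clampReal R (β.1.snd i + r) = _ ∨ _ < clampReal R (β.1.snd i + r)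
    have := (abs_le.1 (β.boundedBy.abs_snd i)).1
    rw [clampReal, max_eq_right (le_min (by linarith [R.2]) (by linarith))]
    rcases le_total (β.1.snd i + r) R with h | h
    · right
      rw [min_eq_right h]
      linarith
    · exact Or.inl (min_eq_left h)

/-- Every hyper-rectangle is the supremum of those way below it. -/
theorem IDom.le_of_forall_wayBelow {ι : Type*} [Finite ι] {R : ℝ≥0} {β γ : IDom ι R}
    (h : ∀ α, WayBelow α β → α ≤ γ) : β ≤ γ := by
  refine IDom.le_iff.2 fun i => ⟨le_of_forall_pos_le_add fun ε hε => ?_,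
    le_of_forall_pos_le_add fun ε hε => ?_⟩
  · have h₁ := (IDom.le_iff.1 (h _ (β.trunc_expand_wayBelow (r := ⟨ε, hε.le⟩) hε)) i).1
    change max _ (min _ (β.1.fst i - ε)) ≤ _ at h₁
    have h₂ := (le_max_right _ _).trans h₁
    rw [min_eq_right (by linarith [(abs_le.1 (β.boundedBy.abs_fst i)).2])] at h₂
    linarith
  · have h₁ := (IDom.le_iff.1 (h _ (β.trunc_expand_wayBelow (r := ⟨ε, hε.le⟩) hε)) i).2
    change _ ≤ max _ (min _ (β.1.snd i + ε)) at h₁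
    refine h₁.trans (max_le ?_ (min_le_right _ _))
    linarith [(abs_le.1 (β.boundedBy.abs_snd i)).1]

/-! ### The passage between rounded ideals and functions -/

section Upper

variable {n : ℕ} {K : ℚ≥0} {a : ℚ}

theorem isLUB_upper (φ : WD n K a) : IsLUB (StepFun.toFun '' φ.carrier) (upper φ) :=
  (exists_upper φ).choose_spec

theorem upper_mono : Monotone (upper (n := n) (K := K) (a := a)) := fun φ ψ h =>
  (isLUB_upper φ).mono (isLUB_upper ψ) (Set.image_mono h)

/-- A directed supremum of rounded ideals is their union, so each step function in it already
belongs to some member. -/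
theorem isLUB_image_upper {d : Set (WD n K a)} (hne : d.Nonempty) (hd : DirectedOn (· ≤ ·) d)
    {φ : WD n K a} (h : IsLUB d φ) : IsLUB (upper '' d) (upper φ) := by
  refine ⟨upper_mono.mem_upperBounds_image h.1, fun g hg => (isLUB_upper φ).2 ?_⟩
  rintro _ ⟨b, hb, rfl⟩
  rw [RoundedIdeal.carrier_eq_of_isLUB hne hd h] at hb
  simp only [Set.mem_iUnion] at hb
  obtain ⟨ψ, hψ, hb⟩ := hb
  exact ((isLUB_upper ψ).1 ⟨b, hb, rfl⟩).trans (hg ⟨ψ, hψ, rfl⟩)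

theorem upper_lower_le (g : Set.Icc (0 : ℝ) a → IDom (Fin n) (K : ℝ≥0)) :
    upper (lower g) ≤ g := by
  refine (isLUB_upper _).2 ?_
  rintro _ ⟨b, hb, rfl⟩
  exact Sep.le hb

/-- `(g_*)^* = g` if `g` is continuous from `[0, a]`, with the rational upper limit topology. -/
theorem upper_lower {g : Set.Icc (0 : ℝ) a → IDom (Fin n) (K : ℝ≥0)}
    (hg : ∀ t b, WayBelow b (g t) → ∃ O ∈ ratIocs a, t ∈ O ∧ ∀ s ∈ O, b ≤ g s) :
    upper (lower g) = g := by
  refine le_antisymm (upper_lower_le g) fun t => IDom.le_of_forall_wayBelow fun α hα => ?_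
  -- Two interpolations give α ≪ b ≪ b' ≪ g(t): continuity puts b' below g on a basic set O, and the
  -- room between b and b' makes the step function with value b on O separated from g.
  obtain ⟨b, hb, hαb, -, hbt⟩ := (goodBases n K a).interpolate _ _ _ hα hα
  obtain ⟨b', hb', hbb', -, hbt'⟩ := (goodBases n K a).interpolate _ _ _ hbt hbt
  obtain ⟨O, hO, ht, h⟩ := hg t b' hbt'
  obtain ⟨θ, hθ, hbθ⟩ := exists_sep_of_le (goodBases n K a) hO hb hb' hbb' h
  exact hαb.le.trans ((hbθ t ht).trans ((isLUB_upper (lower g)).1 ⟨θ, hθ, rfl⟩ t))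

end Upper

/-! ### Partition points and step lengths -/

namespace RatPartition

variable {a : ℚ} (Q : RatPartition a)

theorem node_mono {i j : Fin (Q.k + 1)} (h : i ≤ j) : (Q.node i : ℝ) ≤ Q.node j := by
  change ((Q.q i : ℚ) : ℝ) ≤ ((Q.q j : ℚ) : ℝ)
  exact_mod_cast Q.strictMono.monotone h

theorem node_castSucc_lt_succ (j : Fin Q.k) : (Q.node j.castSucc : ℝ) < Q.node j.succ := by
  change ((Q.q j.castSucc : ℚ) : ℝ) < ((Q.q j.succ : ℚ) : ℝ)
  exact_mod_cast Q.strictMono j.castSucc_lt_succ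

theorem node_zero : (Q.node 0 : ℝ) = 0 := by
  simp [node, Q.q_zero]

theorem ne_zero_of_node_lt {i : Fin (Q.k + 1)} {x : Set.Icc (0 : ℝ) a} (h : (Q.node i : ℝ) < x) :
    (x : ℝ) ≠ 0 :=
  ((Q.node i).2.1.trans_lt h).ne'

theorem index_eq {j : Fin Q.k} {x : Set.Icc (0 : ℝ) a} (hx : (x : ℝ) ≠ 0)
    (h₁ : (Q.node j.castSucc : ℝ) < x) (h₂ : (x : ℝ) ≤ Q.node j.succ) : Q.index x hx = j := by
  obtain ⟨h₃, h₄⟩ := (Q.exists_index x hx).choose_spec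
  change (Q.node (Q.index x hx).castSucc : ℝ) < x at h₃
  change (x : ℝ) ≤ Q.node (Q.index x hx).succ at h₄
  rcases lt_trichotomy (Q.index x hx) j with h | h | h
  · have := Q.node_mono (Fin.succ_le_castSucc_iff.2 h)
    linarith
  · exact h
  · have := Q.node_mono (Fin.succ_le_castSucc_iff.2 h)
    linarith

theorem coe_step (j : Fin Q.k) : (Q.step j : ℝ) = Q.node j.succ - Q.node j.castSucc := by
  change ((Q.q j.succ - Q.q j.castSucc : ℚ) : ℝ) = (Q.q j.succ : ℝ) - (Q.q j.castSucc : ℝ)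
  push_cast
  rfl

theorem step_le_one (hQ : Q.norm ≤ 1) (j : Fin Q.k) :
    (Q.node j.succ : ℝ) - Q.node j.castSucc ≤ 1 := by
  have h : Q.q j.succ - Q.q j.castSucc ≤ Q.norm :=
    Finset.le_sup' (fun j : Fin Q.k => Q.q j.succ - Q.q j.castSucc) (Finset.mem_univ j)
  change (Q.q j.succ : ℝ) - (Q.q j.castSucc : ℝ) ≤ 1
  exact_mod_cast h.trans hQ

end RatPartition

/-! ### The Euler operators -/

section Operators

variable {n : ℕ} {K M : ℚ≥0} {M₁ : ℝ≥0} {a : ℚ}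

/-- The value of `u' · u` at the truncation of `α ⊕ r`. -/
def secondOrderTerm (u : IDom (Fin n) (K : ℝ≥0) → IDom (Fin n) (M : ℝ≥0))
    (u' : IDom (Fin n) (K : ℝ≥0) → IDom (Fin n × Fin n) M₁) (r : ℝ≥0)
    (α : IDom (Fin n) (K : ℝ≥0)) : Box (Fin n) :=
  matVec (u' (trunc (K : ℝ≥0) (expand α.1 r))).1 (u (trunc (K : ℝ≥0) (expand α.1 r))).1

/-- One step of `Φ_{(u,u')}(Q)`, from the enclosure `α` at `s` to the point `x`. -/
noncomputable def phiStep (u : IDom (Fin n) (K : ℝ≥0) → IDom (Fin n) (M : ℝ≥0))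
    (u' : IDom (Fin n) (K : ℝ≥0) → IDom (Fin n × Fin n) M₁) (r : ℝ≥0)
    (α : IDom (Fin n) (K : ℝ≥0)) (s x : ℝ) (h : s ≤ x) : IDom (Fin n) (K : ℝ≥0) :=
  trunc (K : ℝ≥0) (eulerStep α.1 (u α).1 (secondOrderTerm u u' r α) s x h)

variable {u : IDom (Fin n) (K : ℝ≥0) → IDom (Fin n) (M : ℝ≥0)}
  {u' : IDom (Fin n) (K : ℝ≥0) → IDom (Fin n × Fin n) M₁} {Q : RatPartition a}

theorem Phi_of_eq_zero (φ : Set.Icc (0 : ℝ) a → IDom (Fin n) (K : ℝ≥0)) {x : Set.Icc (0 : ℝ) a}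
    (hx : (x : ℝ) = 0) : Phi u u' Q φ x = zeroBox n K := by
  rw [Phi, dif_pos hx]

theorem Phi_of_mem (φ : Set.Icc (0 : ℝ) a → IDom (Fin n) (K : ℝ≥0)) {x : Set.Icc (0 : ℝ) a}
    {j : Fin Q.k} (h₁ : (Q.node j.castSucc : ℝ) < x) (h₂ : (x : ℝ) ≤ Q.node j.succ) :
    Phi u u' Q φ x =
      phiStep u u' (M * Q.step j) (φ (Q.node j.castSucc)) (Q.node j.castSucc) x h₁.le := by
  have hx := Q.ne_zero_of_node_lt h₁
  obtain rfl := Q.index_eq hx h₁ h₂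
  rw [Phi, dif_neg hx]
  rfl

theorem secondOrderTerm_mono (hu : Monotone u) (hu' : Monotone u') (r : ℝ≥0)
    {α β : IDom (Fin n) (K : ℝ≥0)} (h : α ≤ β) :
    secondOrderTerm u u' r β ≤ secondOrderTerm u u' r α :=
  matVec_mono (hu' (trunc_mono _ (expand_mono h r))) (hu (trunc_mono _ (expand_mono h r)))

theorem Phi_mono (hu : Monotone u) (hu' : Monotone u') : Monotone (Phi u u' Q) := by
  intro φ ψ h x
  by_cases hx : (x : ℝ) = 0
  · rw [Phi_of_eq_zero _ hx, Phi_of_eq_zero _ hx]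
  · obtain ⟨j, h₁, h₂⟩ := Q.exists_index x hx
    rw [Phi_of_mem _ h₁ h₂, Phi_of_mem _ h₁ h₂]
    exact trunc_mono _ (eulerStep_mono (h _) (hu (h _)) (secondOrderTerm_mono hu hu' _ (h _)) _)

theorem EulerF_mono (hu : Monotone u) (hu' : Monotone u') : Monotone (EulerF u u' Q) :=
  fun _ _ h => lowerStar_mono (goodBases n K a) (Phi_mono hu hu' (upper_mono h))

/-- `Φ_{(u,u')}(Q)(φ)` is continuous for the rational upper limit topology. -/
theorem exists_ratIoc_le_Phi (φ : Set.Icc (0 : ℝ) a → IDom (Fin n) (K : ℝ≥0))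
    (x : Set.Icc (0 : ℝ) a) (b : IDom (Fin n) (K : ℝ≥0)) (hb : WayBelow b (Phi u u' Q φ x)) :
    ∃ O ∈ ratIocs a, x ∈ O ∧ ∀ s ∈ O, b ≤ Phi u u' Q φ s := by
  by_cases hx : (x : ℝ) = 0
  · refine ⟨_, ⟨-1, 0, rfl⟩, ?_, ?_⟩
    · simp [hx]
    · rintro s ⟨-, hs⟩
      have hs₀ : (s : ℝ) = 0 := le_antisymm (by simpa using hs) s.2.1
      rw [show s = x from Subtype.ext (hs₀.trans hx.symm)]
      exact hb.le
  · obtain ⟨j, h₁, h₂⟩ := Q.exists_index x hx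
    rw [Phi_of_mem _ h₁ h₂] at hb
    set α := φ (Q.node j.castSucc)
    set w := secondOrderTerm u u' (M * Q.step j) α
    set s₀ : ℝ := (Q.node j.castSucc : ℝ)
    have hcont : ∀ c d e : ℝ, Continuous fun s : ℝ =>
        clampReal (K : ℝ≥0) (c + ((s - s₀) * d + (s - s₀) ^ 2 / 2 * e)) := fun c d e =>
      (continuous_clampReal _).comp (by fun_prop)
    have hev : ∀ᶠ s : ℝ in 𝓝 (x : ℝ), ∀ (h : s₀ ≤ s),
        b ≤ phiStep u u' (M * Q.step j) α s₀ s h := by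
      -- A bound of b on the boundary of the cube is satisfied automatically after clamping; any
      -- other one is a strict inequality at x, which persists nearby by continuity of the
      -- polynomial.
      have hev' : ∀ᶠ s : ℝ in 𝓝 (x : ℝ), ∀ i,
          b.1.fst i ≤ clampReal (K : ℝ≥0)
            (α.1.fst i + ((s - s₀) * (u α).1.fst i + (s - s₀) ^ 2 / 2 * w.fst i)) ∧
          clampReal (K : ℝ≥0)
            (α.1.snd i + ((s - s₀) * (u α).1.snd i + (s - s₀) ^ 2 / 2 * w.snd i)) ≤ b.1.snd i := by
        refine eventually_all.2 fun i => ?_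
        obtain ⟨hfst, hsnd⟩ := hb.lt i
        change _ ∨ _ < clampReal _ ((eulerStep _ _ _ _ _ _).fst i) at hfst
        change _ ∨ clampReal _ ((eulerStep _ _ _ _ _ _).snd i) < _ at hsnd
        rw [eulerStep_fst] at hfst
        rw [eulerStep_snd] at hsnd
        refine Eventually.and ?_ ?_
        · rcases hfst with e | e
          · rw [e]
            exact Eventually.of_forall fun s => le_max_left _ _
          · exact (((hcont _ _ _).tendsto _).eventually (lt_mem_nhds e)).mono fun s hs => hs.le
        · rcases hsnd with e | e
          · rw [e]
            exact Eventually.of_forall fun s =>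
              max_le ((neg_nonpos.2 (K : ℝ≥0).2).trans (K : ℝ≥0).2) (min_le_left _ _)
          · exact (((hcont _ _ _).tendsto _).eventually (gt_mem_nhds e)).mono fun s hs => hs.le
      filter_upwards [hev'] with s hs h
      refine IDom.le_iff.2 fun i => ?_
      change _ ≤ clampReal _ ((eulerStep _ _ _ _ _ _).fst i) ∧
        clampReal _ ((eulerStep _ _ _ _ _ _).snd i) ≤ _
      rw [eulerStep_fst, eulerStep_snd]
      exact hs i
    obtain ⟨l, r, ⟨hl, hr⟩, hlr⟩ := mem_nhds_iff_exists_Ioo_subset.1 hev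
    obtain ⟨p, hp, hpx⟩ := exists_rat_btwn (max_lt hl h₁)
    -- The right end must not pass q_{j+1}, where the formula changes. If x = q_{j+1}, the rational
    -- point q_{j+1} itself is taken, which is possible because the basic sets are closed on the
    -- right.
    obtain ⟨q, hxq, hqr, hqj⟩ : ∃ q : ℚ, (x : ℝ) ≤ q ∧ (q : ℝ) < r ∧ (q : ℝ) ≤ Q.node j.succ := by
      rcases h₂.eq_or_lt with e | e
      · exact ⟨Q.q j.succ, e.le, lt_of_eq_of_lt e.symm hr, le_rfl⟩
      · obtain ⟨q, hq, hq'⟩ := exists_rat_btwn (lt_min hr e)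
        exact ⟨q, hq.le, hq'.trans_le (min_le_left _ _), hq'.le.trans (min_le_right _ _)⟩
    refine ⟨_, ⟨p, q, rfl⟩, ⟨hpx, hxq⟩, ?_⟩
    rintro s ⟨hps, hsq⟩
    have hs₁ : s₀ < s := (le_max_right _ _).trans_lt (hp.trans hps)
    rw [Phi_of_mem _ hs₁ (hsq.trans hqj)]
    exact hlr ⟨(le_max_left _ _).trans_lt (hp.trans hps), hsq.trans_lt hqr⟩ hs₁.le

/-- This removes the round trip through rounded ideals: iterating `EulerF` on ideals amounts to
iterating `Phi` on functions. -/
theorem upper_EulerF (φ : WD n K a) : upper (EulerF u u' Q φ) = Phi u u' Q (upper φ) :=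
  upper_lower (exists_ratIoc_le_Phi _)

/-! ### Scott continuity -/

theorem BoxTendsto.eventually_phiStep {J : Type*} [Preorder J] [IsDirectedOrder J] [Nonempty J]
    (hu : ScottContinuous u) (hu' : ScottContinuous u') (r : ℝ≥0)
    {α : J → IDom (Fin n) (K : ℝ≥0)} (hα : Monotone α) {A : IDom (Fin n) (K : ℝ≥0)}
    (h : BoxTendsto (fun j => (α j).1) atTop A.1) {ε : ℝ} (hε : 0 < ε) :
    ∀ᶠ j in atTop, ∀ s x : ℝ, ∀ h : s ≤ x, x - s ≤ 1 → ∀ i,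
      (phiStep u u' r A s x h).1.fst i ≤ (phiStep u u' r (α j) s x h).1.fst i + ε ∧
      (phiStep u u' r (α j) s x h).1.snd i ≤ (phiStep u u' r A s x h).1.snd i + ε := by
  have hG : BoxTendsto (fun j => (EulerDomain.trunc (K : ℝ≥0) (EulerDomain.expand (α j).1 r)).1)
    atTop (EulerDomain.trunc (K : ℝ≥0) (EulerDomain.expand A.1 r)).1 := (h.expand r).trunc _
  have hGm : Monotone fun j => EulerDomain.trunc (K : ℝ≥0) (EulerDomain.expand (α j).1 r) :=
    fun j j' hj => trunc_mono _ (expand_mono (hα hj) r)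
  have hw : BoxTendsto (fun j => secondOrderTerm u u' r (α j)) atTop (secondOrderTerm u u' r A) :=
    (hG.scottContinuous hu' hGm).matVec (hG.scottContinuous hu hGm)
  filter_upwards [h.eventually_eulerStep (h.scottContinuous hu hα) hw hε] with j hj s x hsx hle i
  obtain ⟨h₁, h₂⟩ := hj s x hsx hle i
  rw [abs_le] at h₁ h₂
  exact ⟨clampReal_le_add hε.le (by linarith), clampReal_le_add hε.le (by linarith)⟩

/-- A step function separated from a step function below `Φ_{(u,u')}(Q)(φ)`, for a directed
supremum `φ`, is below `Φ_{(u,u')}(Q)` of a member of the directed family. -/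
theorem exists_le_Phi_upper (hu : ScottContinuous u) (hu' : ScottContinuous u') (hQ : Q.norm ≤ 1)
    {d : Set (WD n K a)} (hne : d.Nonempty) (hd : DirectedOn (· ≤ ·) d) {φ : WD n K a}
    (hφ : IsLUB d φ) {η θ : BaseD n K a} (hηθ : StepSep η θ) (hθ : θ.1 ≤ Phi u u' Q (upper φ)) :
    ∃ ψ ∈ d, η.1 ≤ Phi u u' Q (upper ψ) := by
  obtain ⟨ε, hε, hgap⟩ := hηθ.exists_gap
  have : Nonempty d := hne.to_subtype
  have : IsDirectedOrder d := ⟨fun x y => by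
    obtain ⟨z, hz, h₁, h₂⟩ := hd x x.2 y y.2
    exact ⟨⟨z, hz⟩, h₁, h₂⟩⟩
  have hmono : ∀ t, Monotone fun ψ : d => upper ψ.1 t := fun t ψ ψ' h => upper_mono h t
  have hlim : ∀ t, BoxTendsto (fun ψ : d => (upper ψ.1 t).1) atTop (upper φ t).1 := fun t => by
    refine IDom.boxTendsto_of_isLUB (hmono t) ?_
    have := isLUB_pi.1 (isLUB_image_upper hne hd hφ) t
    rwa [← Set.image_comp, Set.image_eq_range] at this
  -- Only the values at the finitely many left endpoints q_j enter `Phi`, so a single member of the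
  -- family achieves accuracy ε on all steps at once.
  obtain ⟨ψ, hψ⟩ := (eventually_all.2 fun j : Fin Q.k =>
    BoxTendsto.eventually_phiStep hu hu' (M * Q.step j) (hmono (Q.node j.castSucc))
      (hlim (Q.node j.castSucc)) hε).exists
  refine ⟨ψ, ψ.2, fun x => ?_⟩
  by_cases hx : (x : ℝ) = 0
  · have h := (((stepSep_iff _ _).1 hηθ x).le).trans (hθ x)
    rwa [Phi_of_eq_zero _ hx] at h ⊢
  · obtain ⟨j, h₁, h₂⟩ := Q.exists_index x hx
    have hx := hθ x
    rw [Phi_of_mem _ h₁ h₂] at hx ⊢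
    rw [IDom.le_iff] at hx ⊢
    intro i
    have hψi := hψ j _ x h₁.le (by linarith [Q.step_le_one hQ j]) i
    -- Truncation keeps the value in the cube, which settles the coordinates where η has a trivial
    -- bound; elsewhere the gap ε absorbs the approximation error.
    have hb := (phiStep u u' (M * Q.step j) (upper ψ.1 (Q.node j.castSucc))
      (Q.node j.castSucc) x h₁.le).boundedBy i
    constructor
    · rcases (hgap x i).1 with e | e
      · exact e.trans_le hb.1
      · linarith [(hx i).1, hψi.1]
    · rcases (hgap x i).2 with e | e
      · exact hb.2.trans_eq e.symm
      · linarith [(hx i).2, hψi.2]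

theorem scottContinuous_EulerF (hu : ScottContinuous u) (hu' : ScottContinuous u')
    (hQ : Q.norm ≤ 1) : ScottContinuous (EulerF u u' Q) := by
  intro d hne hd φ hφ
  refine ⟨(EulerF_mono hu.monotone hu'.monotone).mem_upperBounds_image hφ.1, fun I hI => ?_⟩
  rintro b ⟨θ₁, θ₂, h₁, h₂, h₃⟩
  -- The interpolant η plays two roles: its separation from θ₂ pays for the passage to a member of
  -- the family, and θ₁ remains separated from η, as membership in `lower` requires.
  obtain ⟨η, hη₁, -, hη₂⟩ := (goodBases n K a).stepSep_interpolate h₂ h₂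
  obtain ⟨ψ, hψ, hle⟩ := exists_le_Phi_upper hu hu' hQ hne hd hφ hη₂ h₃
  exact hI ⟨ψ, hψ, rfl⟩ ⟨θ₁, η, h₁, hη₁, hle⟩

/-! ### The second-order Euler enclosure -/

theorem boundedBy_pure_zero {ι : Type*} {r : ℝ} (hr : 0 ≤ r) :
    BoundedBy (NonemptyInterval.pure (0 : ι → ℝ)) r := fun _ =>
  ⟨neg_nonpos.2 hr, hr⟩

/-- The default value 0 obeys the same bound, so growth of the recursion can be estimated before its
arguments are known to lie in the cube; this avoids a circular argument. -/
theorem boundedBy_applyBox {ι κ : Type*} {R L : ℝ≥0} (w : IDom ι R → IDom κ L) (α : Box ι) :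
    BoundedBy (applyBox w α) L := by
  rw [applyBox]
  split_ifs with h
  · exact IDom.boundedBy _
  · exact boundedBy_pure_zero L.2

theorem applyBox_coe {ι κ : Type*} {R L : ℝ≥0} (w : IDom ι R → IDom κ L) (α : IDom ι R) :
    applyBox w α.1 = (w α).1 :=
  dif_pos α.2

/-- The first-order term is bounded by M and the matrix-vector product by nM₁M, a sum of n products;
together they give the rate M(1 + nM₁). -/
theorem boundedBy_e2Step {j : Fin Q.k} {α : Box (Fin n)} {r : ℝ} (hα : BoundedBy α r)
    {x : Set.Icc (0 : ℝ) a} (h : (Q.node j.castSucc : ℝ) ≤ x)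
    (h₁ : (x : ℝ) - Q.node j.castSucc ≤ 1) :
    BoundedBy (e2Step u u' Q j α x h)
      (r + (x - Q.node j.castSucc) * ((M : ℝ≥0) * (1 + n * M₁))) := by
  have h₂ : BoundedBy (matVec (applyBox u' (expand α (M * Q.step j)))
      (applyBox u (expand α (M * Q.step j)))) (n * (M₁ * (M : ℝ≥0))) :=
    (boundedBy_applyBox _ _).matVec (boundedBy_applyBox _ _) M₁.2
  have := hα.eulerStep (boundedBy_applyBox u α) h₂ (by positivity) h h₁
  refine this.mono (le_of_eq ?_)
  ring

theorem e2Node_succ (j : Fin Q.k) :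
    e2Node u u' Q j.succ = e2Step u u' Q j (e2Node u u' Q j.castSucc) (Q.node j.succ)
      (Q.node_castSucc_lt_succ j).le := by
  simp only [e2Node, Fin.induction_succ]

theorem boundedBy_e2Node (hQ : Q.norm ≤ 1) (i : Fin (Q.k + 1)) :
    BoundedBy (e2Node u u' Q i) (Q.node i * ((M : ℝ≥0) * (1 + n * M₁))) := by
  induction i using Fin.induction with
  | zero =>
    rw [Q.node_zero, zero_mul]
    exact boundedBy_pure_zero le_rfl
  | succ j ih =>
    rw [e2Node_succ]
    refine (boundedBy_e2Step ih _ (Q.step_le_one hQ j)).mono (le_of_eq ?_)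
    ring

theorem E2_of_eq_zero {x : Set.Icc (0 : ℝ) a} (hx : (x : ℝ) = 0) :
    E2 u u' Q x = NonemptyInterval.pure 0 := by
  rw [E2, dif_pos hx]

theorem E2_of_mem {x : Set.Icc (0 : ℝ) a} {j : Fin Q.k} (h₁ : (Q.node j.castSucc : ℝ) < x)
    (h₂ : (x : ℝ) ≤ Q.node j.succ) :
    E2 u u' Q x = e2Step u u' Q j (e2Node u u' Q j.castSucc) x h₁.le := by
  have hx := Q.ne_zero_of_node_lt h₁
  obtain rfl := Q.index_eq hx h₁ h₂
  rw [E2, dif_neg hx]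

theorem E2_node (i : Fin (Q.k + 1)) : E2 u u' Q (Q.node i) = e2Node u u' Q i := by
  cases i using Fin.cases with
  | zero => exact E2_of_eq_zero Q.node_zero
  | succ j => rw [E2_of_mem (Q.node_castSucc_lt_succ j) le_rfl, e2Node_succ]

/-- The expansion costs MΔ_j ≤ Δ_j M(1 + nM₁), no more than the growth allowance up to q_{j+1} ≤ a,
so the total is at most aM(1 + nM₁) ≤ K. -/
theorem boundedBy_expand_e2Node (hQ : Q.norm ≤ 1)
    (ha : (a : ℝ) * ((M : ℝ≥0) * (1 + n * M₁)) ≤ (K : ℝ≥0)) (j : Fin Q.k) :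
    BoundedBy (expand (e2Node u u' Q j.castSucc) (M * Q.step j)) (K : ℝ≥0) := by
  refine ((boundedBy_e2Node hQ j.castSucc).expand _).mono (le_trans ?_ ha)
  have h₁ : (Q.node j.succ : ℝ) ≤ a := (Q.node j.succ).2.2
  have h₂ := (Q.node_castSucc_lt_succ j).le
  have hM : (0 : ℝ) ≤ ((M : ℝ≥0) : ℝ) := (M : ℝ≥0).2
  have hn : (0 : ℝ) ≤ n * M₁ := by positivity
  rw [NNReal.coe_mul, Q.coe_step]
  nlinarith [mul_nonneg (mul_nonneg (sub_nonneg.2 h₂) hM) hn,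
    mul_nonneg (sub_nonneg.2 h₁) (mul_nonneg hM (by linarith : (0 : ℝ) ≤ 1 + n * M₁))]

theorem boundedBy_E2 (hQ : Q.norm ≤ 1)
    (ha : (a : ℝ) * ((M : ℝ≥0) * (1 + n * M₁)) ≤ (K : ℝ≥0)) (x : Set.Icc (0 : ℝ) a) :
    BoundedBy (E2 u u' Q x) (K : ℝ≥0) := by
  by_cases hx : (x : ℝ) = 0
  · rw [E2_of_eq_zero hx]
    exact boundedBy_pure_zero (K : ℝ≥0).2
  · obtain ⟨j, h₁, h₂⟩ := Q.exists_index x hx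
    rw [E2_of_mem h₁ h₂]
    refine (boundedBy_e2Step (boundedBy_e2Node hQ _) _
      (by linarith [Q.step_le_one hQ j])).mono (le_trans (le_of_eq ?_)
        ((mul_le_mul_of_nonneg_right x.2.2 (by positivity)).trans ha))
    ring

/-- `Φ_{(u,u')}(Q)` extends a correct value at `q_j` to the whole of `(q_j, q_{j+1}]`. -/
theorem Phi_eq_E2 (hQ : Q.norm ≤ 1) (ha : (a : ℝ) * ((M : ℝ≥0) * (1 + n * M₁)) ≤ (K : ℝ≥0))
    {φ : Set.Icc (0 : ℝ) a → IDom (Fin n) (K : ℝ≥0)} {j : Fin Q.k}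
    (hφ : (φ (Q.node j.castSucc)).1 = e2Node u u' Q j.castSucc) {x : Set.Icc (0 : ℝ) a}
    (h₁ : (Q.node j.castSucc : ℝ) < x) (h₂ : (x : ℝ) ≤ Q.node j.succ) :
    (Phi u u' Q φ x).1 = E2 u u' Q x := by
  have hG := boundedBy_expand_e2Node (u := u) (u' := u') hQ ha j
  have hE := boundedBy_E2 (u := u) (u' := u') hQ ha x
  rw [E2_of_mem h₁ h₂] at hE ⊢
  rw [← hφ] at hG hE ⊢
  have e : e2Step u u' Q j (φ (Q.node j.castSucc)).1 x h₁.le =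
      eulerStep (φ (Q.node j.castSucc)).1 (u (φ (Q.node j.castSucc))).1
        (secondOrderTerm u u' (M * Q.step j) (φ (Q.node j.castSucc)))
        (Q.node j.castSucc) x h₁.le := by
    -- By `hG` the expanded hyper-rectangle equals its truncation, so the partial applications of
    -- `e2Step` agree with the total ones in `Phi`.
    rw [secondOrderTerm, ← applyBox_coe u, ← applyBox_coe u, ← applyBox_coe u',
      coe_trunc_of_boundedBy hG]
    rfl
  rw [Phi_of_mem _ h₁ h₂, phiStep, ← e, coe_trunc_of_boundedBy hE]

/-- One application fixes the value at q_0 = 0, whatever the argument, and each further one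
propagates correctness from q_j to q_{j+1}. The inequality is strict because ⊥ itself is not yet
correct at 0. -/
theorem upper_iterate_node (hQ : Q.norm ≤ 1)
    (ha : (a : ℝ) * ((M : ℝ≥0) * (1 + n * M₁)) ≤ (K : ℝ≥0)) (m : ℕ) (i : Fin (Q.k + 1))
    (hi : (i : ℕ) < m) :
    (upper ((EulerF u u' Q)^[m] ⊥) (Q.node i)).1 = e2Node u u' Q i := by
  induction m generalizing i with
  | zero => exact absurd hi (Nat.not_lt_zero _)
  | succ m ih =>
    rw [Function.iterate_succ_apply', upper_EulerF]
    cases i using Fin.cases with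
    | zero => rw [Phi_of_eq_zero _ Q.node_zero]; rfl
    | succ j =>
      have hj : (j : ℕ) < m := by simpa using hi
      rw [Phi_eq_E2 hQ ha (ih j.castSucc hj) (Q.node_castSucc_lt_succ j) le_rfl, E2_node]

theorem upper_iterate (hQ : Q.norm ≤ 1)
    (ha : (a : ℝ) * ((M : ℝ≥0) * (1 + n * M₁)) ≤ (K : ℝ≥0)) {m : ℕ} (hm : Q.k ≤ m)
    (x : Set.Icc (0 : ℝ) a) :
    (upper ((EulerF u u' Q)^[m + 1] ⊥) x).1 = E2 u u' Q x := by
  rw [Function.iterate_succ_apply', upper_EulerF]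
  by_cases hx : (x : ℝ) = 0
  · rw [Phi_of_eq_zero _ hx, E2_of_eq_zero hx]
    rfl
  · obtain ⟨j, h₁, h₂⟩ := Q.exists_index x hx
    -- After m ≥ k applications all left endpoints q_0, …, q_{k-1} are correct, and the last
    -- application fills in every interval.
    exact Phi_eq_E2 hQ ha (upper_iterate_node hQ ha m j.castSucc (j.2.trans_le hm)) h₁ h₂

theorem iterate_succ_eq (hQ : Q.norm ≤ 1)
    (ha : (a : ℝ) * ((M : ℝ≥0) * (1 + n * M₁)) ≤ (K : ℝ≥0)) :
    EulerF u u' Q ((EulerF u u' Q)^[Q.k + 1] ⊥) = (EulerF u u' Q)^[Q.k + 1] ⊥ := by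
  -- An ideal in the image of the operator is `lower` of its own `upper`, so two such ideals with
  -- the same upper function coincide. For general ideals this need not be available, hence the
  -- exponent m + 1.
  have key : ∀ m,
      (EulerF u u' Q)^[m + 1] ⊥ = lower (upper ((EulerF u u' Q)^[m + 1] ⊥)) := fun m => by
    rw [Function.iterate_succ_apply', upper_EulerF]
    rfl
  have h : upper ((EulerF u u' Q)^[Q.k + 1 + 1] ⊥) = upper ((EulerF u u' Q)^[Q.k + 1] ⊥) := by
    funext x
    exact IDom.box_injective ((upper_iterate hQ ha (Nat.le_succ Q.k) x).trans
      (upper_iterate hQ ha le_rfl x).symm)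
  rw [← Function.iterate_succ_apply' (EulerF u u' Q), key, h, ← key]

end Operators

/-! ### The least fixpoint and the theorem -/

/-- If the iteration of a monotone map from the bottom element becomes stationary, then it has
reached the least fixpoint. -/
theorem isLeast_fixedPoints_of_iterate {P : Type*} [PartialOrder P] [OrderBot P] {F : P → P}
    (hF : Monotone F) {m : ℕ} (h : F (F^[m] ⊥) = F^[m] ⊥) :
    IsLeast (Function.fixedPoints F) (F^[m] ⊥) ∧
      IsLUB (Set.range fun l : ℕ => F^[l] ⊥) (F^[m] ⊥) := by
  have hle : ∀ y, F y = y → ∀ l, F^[l] ⊥ ≤ y := fun y hy l => by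
    have := hF.iterate l (bot_le : ⊥ ≤ y)
    rwa [Function.iterate_fixed hy] at this
  refine ⟨⟨h, fun y hy => hle y hy m⟩, ?_, fun y hy => hy ⟨m, rfl⟩⟩
  rintro _ ⟨l, rfl⟩
  exact hle _ h l

end EulerDomain

theorem mainTheorem2 (n : ℕ) (hn : 1 ≤ n) (K M : ℚ≥0) (hK : 0 < K) (hM : 0 < M) (M₁ : ℝ≥0)
    (f : Cube (Fin n) (K : ℝ≥0) → Cube (Fin n) (M : ℝ≥0))
    (hf : ∀ x y i, |(f x : Fin n → ℝ) i - (f y : Fin n → ℝ) i| ≤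
      M₁ * ∑ j, |(x : Fin n → ℝ) j - (y : Fin n → ℝ) j|)
    (a : ℚ) (ha₀ : 0 < a) (ha : (a : ℝ) ≤ K / (M * (1 + n * M₁)))
    (Q : RatPartition a) (hQ : Q.norm ≤ 1)
    (u : IDom (Fin n) (K : ℝ≥0) → IDom (Fin n) (M : ℝ≥0))
    (u' : IDom (Fin n) (K : ℝ≥0) → IDom (Fin n × Fin n) M₁)
    (huu' : (u, u') ∈ V1f M₁ f) :
    (∀ j : Fin Q.k,
      (expand (E2 u u' Q (Q.node j.castSucc)) (M * Q.step j) : Set (Fin n → ℝ)) ⊆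
        Cube (Fin n) (K : ℝ≥0)) ∧
    ScottContinuous (EulerF u u' Q) ∧
    ∃ y : WD n K a,
      IsLeast (Function.fixedPoints (EulerF u u' Q)) y ∧
      IsLUB (Set.range fun m : ℕ => (EulerF u u' Q)^[m] ⊥) y ∧
      y = (EulerF u u' Q)^[Q.k + 1] ⊥ ∧
      ∀ x, E2 u u' Q x = (upper y x).1 := by
  obtain ⟨⟨hu, hu', -⟩, -⟩ := huu'
  have hM' : (0 : ℝ) < M := by exact_mod_cast hM
  have ha' : (a : ℝ) * ((M : ℝ≥0) * (1 + n * M₁)) ≤ (K : ℝ≥0) :=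
    (le_div_iff₀ (by positivity)).1 ha
  have hF := scottContinuous_EulerF hu hu' hQ
  obtain ⟨h₁, h₂⟩ := isLeast_fixedPoints_of_iterate hF.monotone
    (iterate_succ_eq (u := u) (u' := u') hQ ha')
  refine ⟨fun j => ?_, hF, _, h₁, h₂, rfl, fun x => (upper_iterate hQ ha' le_rfl x).symm⟩
  rw [E2_node, box_subset_cube_iff]
  exact boundedBy_expand_e2Node hQ ha' j
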